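/- Random variables with the same distribution are identified. For a distribution function $F$ put $F^{-1}(u)=\inf\{x: F(x)\ge u\}$, $0<u<1$, and $L(u)=-\log(1-u)$. Let $\mathcal H_0$ be the set of random variables whose inverse distribution function has the form $F^{-1}(u)=H(L(u))$, $0<u<1$, where $H:(0,\infty)\to\mathbb R$ is non-constant, non-decreasing, left continuous, with $\int_0^\infty y^m e^{-y}|H(y)|\,dy<\infty$ for $m=0,1,\dots$, $\int_0^\infty e^{-y}H(y)\,dy=0$ and $\int_0^\infty y e^{-y}H(y)\,dy=1$. Let $\mathcal T$ be the set of random variables $T$ with $\Pr(T>0)=1$ and finite moments of every order. For $X\in\mathcal H_0$ with distribution function $F$ let $\varphi(X)$ be the random variable $L(F(V))$, where $V$ has density $(1-F)L(F)/\int_{\mathbb R}(1-F(y))L(F(y))\,dy$ (with $(1-F)L(F):=0$ where $F\in\{0,1\}$). The expected record sequence of $X$ is $\rho_n=\mathbb E R_n$, $R_n=F^{-1}(U_n)$, $n\ge1$, where $U_1<U_2<\cdots$ are the successive (upper) record values of an i.i.d. sequence of uniform $(0,1)$ random variables, the first observation being the first record. Let $f_T(t)=e^{-(\log t)^2/2}/(t\sqrt{2\pi})$,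 $t>0$, be the lognormal density, and for $-1\le\lambda\le1$ let $T_\lambda$ have density $f_\lambda(t)=(1+\lambda\sin(\pi\log t))f_T(t)$, $t>0$. Then: (a) For every $\lambda\in[-1,1]$, $T_\lambda\in\mathcal T$ and $\mathbb E T_\lambda^n=e^{n^2/2}$ for $n=0,1,\dots$; there is exactly one $X_\lambda\in\mathcal H_0$ with $\varphi(X_\lambda)=T_\lambda$, that is, $X_\lambda=\varphi^{-1}(T_\lambda)$. It is absolutely continuous, and its inverse distribution function is $$G_\lambda(u)=\int_1^{-\log(1-u)}\frac{e^y}{y}f_\lambda(y)\,dy+\int_0^1\frac{e^t-1}{t}f_\lambda(t)\,dt-\int_1^\infty\frac1t f_\lambda(t)\,dt,\qquad 0<u<1.$$ (b) All the $X_\lambda$ have the same expected record sequence: for $n\ge 1$ and $\lambda\in[-1,1]$ the record $R_n$ of $X_\lambda$ is integrable and $$\rho_n=\int_0^1\frac{L(u)^{n-1}}{(n-1)!}G_\lambda(u)\,du=\sum_{k=0}^{n-2}\frac{e^{k^2/2}}{(k+1)!},$$ where an empty sum is zero. (c) If $\lambda_1\ne\lambda_2$ in $[-1,1]$, then $X_{\lambda_1}\neq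 X_{\lambda_2}$ (their distributions differ), and $g=G_{\lambda_1}-G_{\lambda_2}$ belongs to the space $\mathcal H(0,1)$ of measurable $g:(0,1)\to\mathbb R$ with $\int_0^1|g(u)|L(u)^k\,du<\infty$ for $k=0,1,\dots$, is non-zero on a set of positive measure, and satisfies $\int_0^1 g(u)L(u)^k\,du=0$ for $k=0,1,\dots$. (d) Consequently the system $\{(-\log(1-u))^k: k=0,1,\dots\}$ is not complete in $\mathcal H(0,1)$: it is not true that every $g\in\mathcal H(0,1)$ with $\int_0^1 g(u)(-\log(1-u))^k\,du=0$ for all $k\ge0$ vanishes almost everywhere. -/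

import Mathlib

open MeasureTheory ProbabilityTheory Set
open scoped ENNReal

noncomputable section

/-! Random variables are identified when they have the same distribution, so a random variable is
represented by its law, a Borel probability measure on the real line. -/

/-- `L(u) = -log(1-u)`. -/
def recL (u : ℝ) : ℝ := -Real.log (1 - u)

/-- The left-continuous inverse distribution function `inf {x : u ≤ F(x)}`, for `0 < u < 1`. -/
def invCdf (μ : Measure ℝ) (u : ℝ) : ℝ := sInf {x : ℝ | u ≤ cdf μ x}

/-- The function space `H^*` of non-constant, non-decreasing, left-continuous functions on `(0,∞)`
with `∫ y^m e^{-y} |H(y)| dy < ∞` for all `m`.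
Values outside `(0,∞)` play no role. -/
structure IsHStarFun (H : ℝ → ℝ) : Prop where
  nonconst : ∃ a ∈ Ioi (0 : ℝ), ∃ b ∈ Ioi (0 : ℝ), H a ≠ H b
  mono : MonotoneOn H (Ioi 0)
  leftCont : ∀ y ∈ Ioi (0 : ℝ), ContinuousWithinAt H (Iio y) y
  integrable : ∀ m : ℕ, IntegrableOn (fun y => y ^ m * Real.exp (-y) * |H y|) (Ioi 0)

/-- The subspace `H_0` of `H^*`. -/
structure IsHZeroFun (H : ℝ → ℝ) : Prop extends IsHStarFun H where
  int_zero : ∫ y in Ioi (0 : ℝ), Real.exp (-y) * H y = 0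
  int_one : ∫ y in Ioi (0 : ℝ), y * Real.exp (-y) * H y = 1

/-- The random variables in `H_0`: the inverse distribution function is `H(-log(1-u))` with `H`
in the function space `H_0`. -/
def HZero : Set (Measure ℝ) :=
  {μ | IsProbabilityMeasure μ ∧
    ∃ H : ℝ → ℝ, IsHZeroFun H ∧ ∀ u ∈ Ioo (0 : ℝ) 1, invCdf μ u = H (recL u)}

/-- The space `T` of positive random variables with finite moments of any order. -/
def TSpace : Set (Measure ℝ) :=
  {ν | IsProbabilityMeasure ν ∧ ν (Ioi 0) = 1 ∧ ∀ n : ℕ, Integrable (fun t : ℝ => t ^ n) ν}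

/-- `(1 - F(x)) L(F(x))`; it is `0` where `F(x) = 1` or `F(x) = 0`. -/
def phiWeight (μ : Measure ℝ) (x : ℝ) : ℝ := (1 - cdf μ x) * recL (cdf μ x)

/-- The law of `V`, with density `(1 - F) L(F) / ∫ (1 - F) L(F)`. -/
def phiV (μ : Measure ℝ) : Measure ℝ :=
  volume.withDensity fun x => ENNReal.ofReal (phiWeight μ x / ∫ y, phiWeight μ y)

/-- The mapping `φ`: the law of `T = L(F(V))`. -/
def phi (μ : Measure ℝ) : Measure ℝ := (phiV μ).map fun x => recL (cdf μ x)

/-- The uniform distribution on `(0,1)`. -/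
def unif : Measure ℝ := volume.restrict (Ioo 0 1)

instance : IsProbabilityMeasure unif :=
  ⟨by simp [unif]⟩

/-- The law of an i.i.d. sequence of uniform random variables. -/
def unifSeq : Measure (ℕ → ℝ) := Measure.infinitePi fun _ : ℕ => unif

/-- The (upper) record times of the sequence `x 0, x 1, …`: `recordTime x 0 = 0` is the first one,
and the next one is the first later index at which the current record is strictly exceeded. -/
def recordTime (x : ℕ → ℝ) : ℕ → ℕ
  | 0 => 0
  | n + 1 => sInf {m : ℕ | recordTime x n < m ∧ x (recordTime x n) < x m}

/-- The `n`-th record value of the sequence `x`, for `n = 1, 2, …`. -/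
def recordValue (x : ℕ → ℝ) (n : ℕ) : ℝ := x (recordTime x (n - 1))

/-- `R_n = F⁻¹(U_n)`, where `U_1 < U_2 < ⋯` is the record process of the i.i.d. uniform
sequence `x`. -/
def recordOf (μ : Measure ℝ) (n : ℕ) (x : ℕ → ℝ) : ℝ := invCdf μ (recordValue x n)

/-- `ρ` is the expected record sequence `ρ_n = E R_n`, `n ≥ 1`, of the law `μ`. -/
def IsExpectedRecordSeq (μ : Measure ℝ) (ρ : ℕ → ℝ) : Prop :=
  ∀ n : ℕ, 1 ≤ n → Integrable (recordOf μ n) unifSeq ∧ ∫ x, recordOf μ n x ∂unifSeq = ρ n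

/-- The density of the standard lognormal law, for `t > 0`. -/
def lognormalPdf (t : ℝ) : ℝ :=
  Real.exp (-(Real.log t) ^ 2 / 2) / (t * Real.sqrt (2 * Real.pi))

/-- Stieltjes' perturbation `(1 + λ sin(π log t)) f_T(t)`, for `t > 0`. -/
def stieltjesPdf (lam t : ℝ) : ℝ :=
  (1 + lam * Real.sin (Real.pi * Real.log t)) * lognormalPdf t

/-- The law of `T_λ`. -/
def stieltjesLaw (lam : ℝ) : Measure ℝ :=
  (volume.restrict (Ioi 0)).withDensity fun t => ENNReal.ofReal (stieltjesPdf lam t)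

/-- The function `G_λ` on `(0,1)`. -/
def stieltjesG (lam u : ℝ) : ℝ :=
  (∫ y in (1 : ℝ)..(-Real.log (1 - u)), Real.exp y / y * stieltjesPdf lam y)
    + (∫ t in (0 : ℝ)..1, (Real.exp t - 1) / t * stieltjesPdf lam t)
    - ∫ t in Ioi (1 : ℝ), 1 / t * stieltjesPdf lam t

/-- The space `H(0,1)` of measurable functions on `(0,1)` with `∫ |g(u)| L(u)^k du < ∞` for
all `k`. -/
def HUnit : Set (ℝ → ℝ) :=
  {g | ∀ k : ℕ, IntegrableOn (fun u => g u * recL u ^ k) (Ioo 0 1)}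

/-- The system `s` is complete in the class `S` of functions on `(0,1)`: the only `g ∈ S` with
`∫ g s_k = 0` for all `k` is `g = 0` (almost everywhere). -/
def IsCompleteIn (s : ℕ → ℝ → ℝ) (S : Set (ℝ → ℝ)) : Prop :=
  ∀ g ∈ S, (∀ k : ℕ, ∫ u in Ioo (0 : ℝ) 1, g u * s k u = 0) →
    ∀ᵐ u ∂(volume.restrict (Ioo (0 : ℝ) 1)), g u = 0

end

/-! ### The densities `stieltjesPdf` and their moments -/

/-! Everything is read off the function `stieltjesH`, with `G_λ = H ∘ L` and `H'(y) = (e^y / y)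
f_λ(y)`. Under `u = 1 - e^(-y)` the integral of `G_λ` against `L^n / n!` becomes that of `H` against
the Gamma density `y^n e^(-y) / n!`. Fubini moves the integration onto `H'`, weighted by the Gamma
tail `e^(-t) ∑ j ≤ n, t^j / j!`. The exponentials cancel: the term `j = 0` cancels the additive
constant of `G_λ`, and each `j ≥ 1` leaves `E T_λ^(j-1) / j!` (`stieltjesSlope_mul_gammaTail`,
`integrableOn_gammaWeight_mul_stieltjesH_and_integral`). So these integrals see `T_λ` only through
its moments, which do not depend on `λ`: after `t = e^x` the perturbation `sin(πx)` is odd about the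
integer mean of a shifted Gaussian (`integral_sin_mul_gaussianPDFReal`).

For `φ`, the substitution `x = H(y)` turns the weight `(1 - F) L(F)` into `y e^(-y) H'(y) = f_λ(y)`,
so `φ(X_λ) = T_λ`. Conversely, integrating `e^t / t` against `φ(μ)` recovers the increments of the
quantile function of `μ` up to a constant factor. The two normalisations of `H_0` then fix the
factor and the additive constant (`eq_stieltjesX_of_phi_eq`).

The law of the uniform records is found by induction: the waiting time for the next record is
geometric given the current value, and the new record is uniform above it. This gives the density
`L^n / n!` (`recordLIntegral_succ`, `recordLIntegral_eq`). Finally, `H'` at `e^(1/2)` separates the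
parameters, so a difference `G_λ₁ - G_λ₂` is nonzero but orthogonal to every `L^k`. -/

theorem exp_mul_pow_mul_stieltjesPdf_exp (lam : ℝ) (n : ℕ) (x : ℝ) :
    Real.exp x * (Real.exp x ^ n * stieltjesPdf lam (Real.exp x)) =
      Real.exp ((n : ℝ) ^ 2 / 2) *
        ((1 + lam * Real.sin (Real.pi * x)) * gaussianPDFReal n 1 x) := by
  -- Completing the square: the factor `e^(nx)` shifts the mean of the Gaussian from `0` to `n`.
  have h : Real.exp ((n : ℝ) ^ 2 / 2) * Real.exp (-(x - n) ^ 2 / 2) =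
      Real.exp x ^ n * Real.exp (-x ^ 2 / 2) := by
    rw [← Real.exp_nat_mul, ← Real.exp_add, ← Real.exp_add]
    congr 1
    ring
  have hs : Real.sqrt (2 * Real.pi) ≠ 0 := (Real.sqrt_pos.2 (by positivity)).ne'
  have he := (Real.exp_pos x).ne'
  simp only [stieltjesPdf, lognormalPdf, gaussianPDFReal, Real.log_exp, NNReal.coe_one, mul_one]
  field_simp
  simp only [neg_div] at h
  linear_combination -(1 + lam * Real.sin (Real.pi * x)) * h

theorem integral_Ioi_zero_comp_exp (g : ℝ → ℝ) :
    ∫ t in Ioi 0, g t = ∫ x, Real.exp x * g (Real.exp x) := by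
  rw [← Real.range_exp, ← image_univ, integral_image_eq_integral_abs_deriv_smul MeasurableSet.univ
    (fun x _ => (Real.hasDerivAt_exp x).hasDerivWithinAt) Real.exp_injective.injOn]
  simp

theorem integrableOn_Ioi_zero_comp_exp (g : ℝ → ℝ) :
    IntegrableOn g (Ioi 0) ↔ Integrable fun x => Real.exp x * g (Real.exp x) := by
  rw [← Real.range_exp, ← image_univ,
    integrableOn_image_iff_integrableOn_abs_deriv_smul MeasurableSet.univ
      (fun x _ => (Real.hasDerivAt_exp x).hasDerivWithinAt) Real.exp_injective.injOn]
  simp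

theorem integrable_sin_mul_gaussianPDFReal (m : ℝ) :
    Integrable fun x => Real.sin (Real.pi * x) * gaussianPDFReal m 1 x :=
  (integrable_gaussianPDFReal m 1).bdd_mul (c := 1) (by fun_prop)
    (ae_of_all _ fun x => by simpa using Real.abs_sin_le_one _)

/-- The reflection `x ↦ 2n - x` fixes the Gaussian and, since `2πn` is a period of the sine,
reverses the sign of the integrand. This needs the mean to be an integer. -/
theorem integral_sin_mul_gaussianPDFReal (n : ℕ) :
    ∫ x, Real.sin (Real.pi * x) * gaussianPDFReal n 1 x = 0 := by
  have h := integral_sub_left_eq_self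
    (fun x => Real.sin (Real.pi * x) * gaussianPDFReal n 1 x) volume (2 * n : ℝ)
  have h2 : ∀ x : ℝ, Real.sin (Real.pi * (2 * n - x)) * gaussianPDFReal n 1 (2 * n - x) =
      -(Real.sin (Real.pi * x) * gaussianPDFReal n 1 x) := by
    intro x
    have e1 : Real.sin (Real.pi * (2 * n - x)) = -Real.sin (Real.pi * x) := by
      rw [show Real.pi * (2 * n - x) = n * (2 * Real.pi) - Real.pi * x by ring,
        Real.sin_nat_mul_two_pi_sub]
    have e2 : gaussianPDFReal n 1 (2 * n - x) = gaussianPDFReal n 1 x := by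
      simp only [gaussianPDFReal]
      congr 3
      ring
    rw [e1, e2, neg_mul]
  simp only [h2, integral_neg] at h
  linarith

theorem integrableOn_pow_mul_stieltjesPdf (lam : ℝ) (n : ℕ) :
    IntegrableOn (fun t => t ^ n * stieltjesPdf lam t) (Ioi 0) := by
  rw [integrableOn_Ioi_zero_comp_exp]
  simp only [exp_mul_pow_mul_stieltjesPdf_exp, add_mul, one_mul, mul_assoc]
  exact ((integrable_gaussianPDFReal _ _).add
    ((integrable_sin_mul_gaussianPDFReal _).const_mul lam)).const_mul _

theorem integral_pow_mul_stieltjesPdf (lam : ℝ) (n : ℕ) :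
    ∫ t in Ioi 0, t ^ n * stieltjesPdf lam t = Real.exp ((n : ℝ) ^ 2 / 2) := by
  rw [integral_Ioi_zero_comp_exp]
  simp only [exp_mul_pow_mul_stieltjesPdf_exp, add_mul, one_mul, mul_assoc]
  rw [integral_const_mul, integral_add (integrable_gaussianPDFReal _ _)
    ((integrable_sin_mul_gaussianPDFReal _).const_mul lam), integral_const_mul,
    integral_sin_mul_gaussianPDFReal, integral_gaussianPDFReal_eq_one _ one_ne_zero]
  simp

theorem lognormalPdf_pos {t : ℝ} (ht : 0 < t) : 0 < lognormalPdf t := by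
  unfold lognormalPdf
  positivity

theorem one_add_mul_sin_nonneg {lam : ℝ} (hlam : lam ∈ Icc (-1 : ℝ) 1) (x : ℝ) :
    0 ≤ 1 + lam * Real.sin x := by
  have h : |lam * Real.sin x| ≤ 1 := by
    rw [abs_mul]
    exact mul_le_one₀ (abs_le.2 hlam) (abs_nonneg _) (Real.abs_sin_le_one x)
  linarith [(abs_le.1 h).1]

theorem stieltjesPdf_nonneg {lam : ℝ} (hlam : lam ∈ Icc (-1 : ℝ) 1) {t : ℝ} (ht : 0 < t) :
    0 ≤ stieltjesPdf lam t :=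
  mul_nonneg (one_add_mul_sin_nonneg hlam _) (lognormalPdf_pos ht).le

theorem measurable_stieltjesPdf (lam : ℝ) : Measurable (stieltjesPdf lam) := by
  unfold stieltjesPdf lognormalPdf
  fun_prop

theorem continuousAt_stieltjesPdf (lam : ℝ) {t : ℝ} (ht : 0 < t) :
    ContinuousAt (stieltjesPdf lam) t := by
  have hs : Real.sqrt (2 * Real.pi) ≠ 0 := (Real.sqrt_pos.2 (by positivity)).ne'
  unfold stieltjesPdf lognormalPdf
  have h1 : ContinuousAt Real.log t := Real.continuousAt_log ht.ne'
  have h2 : t * Real.sqrt (2 * Real.pi) ≠ 0 := mul_ne_zero ht.ne' hs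
  fun_prop (disch := assumption)

/-- The zeros of the density `stieltjesPdf lam` on `(0,∞)` form a countable set. -/
theorem countable_stieltjesPdf_eq_zero {lam : ℝ} (hlam : lam ∈ Icc (-1 : ℝ) 1) :
    {t ∈ Ioi (0 : ℝ) | stieltjesPdf lam t = 0}.Countable := by
  refine (countable_range fun k : ℤ => Real.exp ((2 * k + 1) / 2)).mono ?_
  rintro t ⟨ht, h0⟩
  have ht : 0 < t := ht
  have h1 : 1 + lam * Real.sin (Real.pi * Real.log t) = 0 := by
    simpa [stieltjesPdf, (lognormalPdf_pos ht).ne'] using h0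
  have h2 : Real.cos (Real.pi * Real.log t) = 0 := by
    have h3 : (lam * Real.sin (Real.pi * Real.log t)) ^ 2 = 1 := by
      rw [show lam * Real.sin (Real.pi * Real.log t) = -1 by linarith]
      norm_num
    have h4 : lam ^ 2 ≤ 1 := by nlinarith [hlam.1, hlam.2]
    have h5 := Real.sin_sq_add_cos_sq (Real.pi * Real.log t)
    rw [mul_pow] at h3
    nlinarith [sq_nonneg (Real.cos (Real.pi * Real.log t)),
      sq_nonneg (Real.sin (Real.pi * Real.log t))]
  obtain ⟨k, hk⟩ := Real.cos_eq_zero_iff.1 h2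
  refine ⟨k, ?_⟩
  have h6 : (2 * k + 1) / 2 = Real.log t :=
    mul_left_cancel₀ Real.pi_ne_zero (by linarith)
  simp only [h6, Real.exp_log ht]

theorem integral_stieltjesLaw (lam : ℝ) (hlam : lam ∈ Icc (-1 : ℝ) 1) (g : ℝ → ℝ) :
    ∫ t, g t ∂(stieltjesLaw lam) = ∫ t in Ioi 0, g t * stieltjesPdf lam t := by
  rw [stieltjesLaw, integral_withDensity_eq_integral_toReal_smul
    (measurable_stieltjesPdf lam).ennreal_ofReal (ae_of_all _ fun _ => ENNReal.ofReal_lt_top)]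
  refine setIntegral_congr_fun measurableSet_Ioi fun t ht => ?_
  simp [ENNReal.toReal_ofReal (stieltjesPdf_nonneg hlam ht), mul_comm]

theorem integrable_stieltjesLaw_iff (lam : ℝ) (hlam : lam ∈ Icc (-1 : ℝ) 1) (g : ℝ → ℝ) :
    Integrable g (stieltjesLaw lam) ↔
      IntegrableOn (fun t => g t * stieltjesPdf lam t) (Ioi 0) := by
  rw [stieltjesLaw, integrable_withDensity_iff (measurable_stieltjesPdf lam).ennreal_ofReal
    (ae_of_all _ fun _ => ENNReal.ofReal_lt_top)]
  refine integrable_congr ?_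
  filter_upwards [ae_restrict_mem measurableSet_Ioi] with t ht
  rw [ENNReal.toReal_ofReal (stieltjesPdf_nonneg hlam ht)]

theorem integrableOn_stieltjesPdf (lam : ℝ) : IntegrableOn (stieltjesPdf lam) (Ioi 0) := by
  simpa using integrableOn_pow_mul_stieltjesPdf lam 0

theorem stieltjesLaw_mem_TSpace {lam : ℝ} (hlam : lam ∈ Icc (-1 : ℝ) 1) :
    stieltjesLaw lam ∈ TSpace := by
  have h0 : ∫⁻ t in Ioi 0, ENNReal.ofReal (stieltjesPdf lam t) = 1 := by
    rw [← ofReal_integral_eq_lintegral_ofReal (integrableOn_stieltjesPdf lam)]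
    · have := integral_pow_mul_stieltjesPdf lam 0
      simp only [pow_zero, one_mul] at this
      simp [this]
    · filter_upwards [ae_restrict_mem measurableSet_Ioi] with t ht
      exact stieltjesPdf_nonneg hlam ht
  refine ⟨⟨by simpa [stieltjesLaw] using h0⟩, ?_, fun n => ?_⟩
  · rw [stieltjesLaw, withDensity_apply _ measurableSet_Ioi]
    simpa using h0
  · exact (integrable_stieltjesLaw_iff lam hlam _).2 (integrableOn_pow_mul_stieltjesPdf lam n)

theorem integral_pow_stieltjesLaw {lam : ℝ} (hlam : lam ∈ Icc (-1 : ℝ) 1) (n : ℕ) :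
    ∫ t, t ^ n ∂(stieltjesLaw lam) = Real.exp ((n : ℝ) ^ 2 / 2) := by
  rw [integral_stieltjesLaw lam hlam, integral_pow_mul_stieltjesPdf]

/-! ### Integrating a primitive against a probability density -/

/-- Fubini for a primitive based at `1`; the subtracted indicator of `t ≤ 1` accounts for that base
point. Only the combined integrand on the right is assumed integrable. -/
theorem integrableOn_mul_intervalIntegral {w k Q : ℝ → ℝ} (hw : Measurable w) (hk : Measurable k)
    (hw0 : ∀ y, 0 < y → 0 ≤ w y) (hwi : IntegrableOn w (Ioi 0)) (htot : ∫ y in Ioi 0, w y = 1)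
    (hQ : ∀ t, 0 < t → ∫ y in Ioi t, w y = Q t)
    (hint : IntegrableOn (fun t => k t * (Q t - if t ≤ 1 then 1 else 0)) (Ioi 0)) :
    IntegrableOn (fun y => w y * ∫ t in (1 : ℝ)..y, k t) (Ioi 0) ∧
      ∫ y in Ioi 0, w y * ∫ t in (1 : ℝ)..y, k t =
        ∫ t in Ioi 0, k t * (Q t - if t ≤ 1 then 1 else 0) := by
  -- `σ t y` is `w y` times the signed indicator that represents `∫ t in 1..y`: `+1` on `1 < t ≤ y`
  -- and `-1` on `y < t ≤ 1`.
  let σ : ℝ → ℝ → ℝ := fun t y =>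
    if 1 < t then (if t ≤ y then w y else 0) else (if y < t then -w y else 0)
  have hσm : Measurable (Function.uncurry σ) := by
    refine Measurable.ite (measurableSet_lt measurable_const measurable_fst) ?_ ?_
    · exact Measurable.ite (measurableSet_le measurable_fst measurable_snd)
        (hw.comp measurable_snd) measurable_const
    · exact Measurable.ite (measurableSet_lt measurable_snd measurable_fst)
        (hw.comp measurable_snd).neg measurable_const
  have hσI : ∀ t, 0 < t → IntegrableOn (σ t) (Ioi 0) := by
    intro t ht
    refine hwi.mono' (hσm.of_uncurry_left.aestronglyMeasurable) ?_
    filter_upwards [ae_restrict_mem measurableSet_Ioi] with y hy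
    have := hw0 y hy
    simp only [σ]
    split_ifs <;> simp [abs_of_nonneg, this]
  have hσ : ∀ t, 0 < t → ∫ y in Ioi 0, σ t y = Q t - if t ≤ 1 then 1 else 0 := by
    intro t ht
    by_cases h : 1 < t
    · have e : σ t = (Ici t).indicator w := by
        ext y
        simp [σ, h, indicator_apply]
      rw [e, setIntegral_indicator measurableSet_Ici, inter_eq_right.2
        (Ici_subset_Ioi.2 ht), integral_Ici_eq_integral_Ioi, hQ t ht, if_neg (not_le.2 h), sub_zero]
    · have e : σ t = (Iio t).indicator (fun y => -w y) := by
        ext y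
        simp [σ, h, indicator_apply]
      rw [e, setIntegral_indicator measurableSet_Iio, Ioi_inter_Iio, integral_neg,
        ← integral_Ioc_eq_integral_Ioo, if_pos (not_lt.1 h), ← hQ t ht, ← htot,
        ← Ioc_union_Ioi_eq_Ioi ht.le, setIntegral_union (Ioc_disjoint_Ioi le_rfl) measurableSet_Ioi
          (hwi.mono_set Ioc_subset_Ioi_self) (hwi.mono_set (Ioi_subset_Ioi ht.le))]
      ring
  -- For fixed `t` the kernel has constant sign in `y`, so the norm passes through the inner
  -- integral and `hint` gives absolute integrability on the product.
  have hσabs : ∀ t, 0 < t → ∫ y in Ioi 0, ‖k t * σ t y‖ = ‖∫ y in Ioi 0, k t * σ t y‖ := by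
    intro t ht
    simp only [norm_mul, integral_const_mul]
    congr 1
    by_cases h : 1 < t
    · have : ∀ y ∈ Ioi (0 : ℝ), 0 ≤ σ t y := fun y hy => by
        have := hw0 y hy
        simp only [σ, h, if_true]
        split_ifs <;> simp [this]
      rw [Real.norm_of_nonneg (setIntegral_nonneg measurableSet_Ioi this)]
      exact setIntegral_congr_fun measurableSet_Ioi fun y hy => Real.norm_of_nonneg (this y hy)
    · have : ∀ y ∈ Ioi (0 : ℝ), σ t y ≤ 0 := fun y hy => by
        have := hw0 y hy
        simp only [σ, h, if_false]
        split_ifs <;> simp [this]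
      rw [Real.norm_of_nonpos (setIntegral_nonpos measurableSet_Ioi this), ← integral_neg]
      exact setIntegral_congr_fun measurableSet_Ioi fun y hy => Real.norm_of_nonpos (this y hy)
  have hΦ : Integrable (Function.uncurry fun t y => k t * σ t y)
      ((volume.restrict (Ioi 0)).prod (volume.restrict (Ioi 0))) := by
    refine (integrable_prod_iff
      ((hk.comp measurable_fst).mul hσm).aestronglyMeasurable).2 ⟨?_, ?_⟩
    · filter_upwards [ae_restrict_mem measurableSet_Ioi] with t ht
      exact (hσI t ht).const_mul (k t)
    · refine hint.norm.congr ?_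
      filter_upwards [ae_restrict_mem measurableSet_Ioi] with t ht
      change _ = ∫ y in Ioi 0, ‖k t * σ t y‖
      rw [hσabs t ht, integral_const_mul, hσ t ht]
  have hinner : ∀ y ∈ Ioi (0 : ℝ), ∫ t in Ioi 0, k t * σ t y = w y * ∫ t in (1 : ℝ)..y, k t := by
    intro y hy
    have hy : 0 < y := hy
    rcases le_total 1 y with h | h
    · have e : ∀ t, k t * σ t y = (Ioc 1 y).indicator (fun t => w y * k t) t := by
        intro t
        simp only [σ, indicator_apply, mem_Ioc]
        split_ifs <;> first | ring1 | (exfalso; grind)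
      simp only [e]
      rw [setIntegral_indicator measurableSet_Ioc, inter_eq_right.2
        (Ioc_subset_Ioi_self.trans (Ioi_subset_Ioi zero_le_one)), integral_const_mul,
        intervalIntegral.integral_of_le h]
    · have e : ∀ t, k t * σ t y = (Ioc y 1).indicator (fun t => -(w y * k t)) t := by
        intro t
        simp only [σ, indicator_apply, mem_Ioc]
        split_ifs <;> first | ring1 | (exfalso; grind)
      simp only [e]
      rw [setIntegral_indicator measurableSet_Ioc, inter_eq_right.2
        (Ioc_subset_Ioi_self.trans (Ioi_subset_Ioi hy.le)), integral_neg, integral_const_mul,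
        intervalIntegral.integral_of_ge h, mul_neg]
  refine ⟨?_, ?_⟩
  · refine hΦ.integral_prod_right.congr ?_
    filter_upwards [ae_restrict_mem measurableSet_Ioi] with y hy
    exact hinner y hy
  · rw [← setIntegral_congr_fun measurableSet_Ioi hinner, ← integral_integral_swap hΦ]
    refine setIntegral_congr_fun measurableSet_Ioi fun t ht => ?_
    simp only [integral_const_mul, hσ t ht]

/-! ### Gamma weights -/

/-- The Gamma density `y ^ n e ^ (-y) / n!`. -/
noncomputable def gammaWeight (n : ℕ) (y : ℝ) : ℝ := y ^ n / (n.factorial : ℝ) * Real.exp (-y)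

/-- The tail `e ^ (-t) ∑ j ≤ n, t ^ j / j!` of the Gamma density. -/
noncomputable def gammaTail (n : ℕ) (t : ℝ) : ℝ :=
  Real.exp (-t) * ∑ j ∈ Finset.range (n + 1), t ^ j / (j.factorial : ℝ)

/-- The sum telescopes: the derivative of the summand added at stage `n + 1` contributes the new
weight and cancels the previous one. -/
theorem hasDerivAt_neg_gammaTail (n : ℕ) (t : ℝ) :
    HasDerivAt (fun t => -gammaTail n t) (gammaWeight n t) t := by
  induction n with
  | zero =>
    simp only [gammaTail, gammaWeight]
    simpa using (hasDerivAt_neg t).exp.fun_neg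
  | succ n ih =>
    have e : (fun t => -gammaTail (n + 1) t) = fun t => -gammaTail n t -
        Real.exp (-t) * (t ^ (n + 1) / ((n + 1).factorial : ℝ)) := by
      ext s
      simp only [gammaTail]
      rw [Finset.sum_range_succ]
      ring
    rw [e]
    refine (ih.sub ((hasDerivAt_neg t).exp.mul
      ((hasDerivAt_pow (n + 1) t).div_const ((n + 1).factorial : ℝ)))).congr_deriv ?_
    simp only [gammaWeight, Nat.factorial_succ, Nat.cast_mul, Nat.add_sub_cancel]
    have h1 : ((n.factorial : ℕ) : ℝ) ≠ 0 := by positivity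
    have h2 : ((n + 1 : ℕ) : ℝ) ≠ 0 := by positivity
    field_simp
    ring

theorem tendsto_gammaTail (n : ℕ) : Filter.Tendsto (gammaTail n) Filter.atTop (nhds 0) := by
  unfold gammaTail
  simp only [Finset.mul_sum]
  rw [← Finset.sum_const_zero (s := Finset.range (n + 1)) (M := ℝ)]
  refine tendsto_finsetSum _ fun j _ => ?_
  have := (Real.tendsto_pow_mul_exp_neg_atTop_nhds_zero j).div_const (j.factorial : ℝ)
  simp only [zero_div] at this
  refine this.congr fun t => ?_
  ring

theorem gammaWeight_nonneg (n : ℕ) {y : ℝ} (hy : 0 ≤ y) : 0 ≤ gammaWeight n y := by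
  unfold gammaWeight
  positivity

theorem measurable_gammaWeight (n : ℕ) : Measurable (gammaWeight n) := by
  unfold gammaWeight
  fun_prop

theorem tendsto_neg_gammaTail (n : ℕ) :
    Filter.Tendsto (fun t => -gammaTail n t) Filter.atTop (nhds 0) := by
  simpa using (tendsto_gammaTail n).neg

theorem integrableOn_gammaWeight (n : ℕ) {t : ℝ} (ht : 0 ≤ t) :
    IntegrableOn (gammaWeight n) (Ioi t) :=
  integrableOn_Ioi_deriv_of_nonneg' (fun y _ => hasDerivAt_neg_gammaTail n y)
    (fun _ hy => gammaWeight_nonneg n (ht.trans (le_of_lt hy))) (tendsto_neg_gammaTail n)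

theorem integral_Ioi_gammaWeight (n : ℕ) {t : ℝ} (ht : 0 ≤ t) :
    ∫ y in Ioi t, gammaWeight n y = gammaTail n t := by
  rw [integral_Ioi_of_hasDerivAt_of_tendsto' (fun y _ => hasDerivAt_neg_gammaTail n y)
    (integrableOn_gammaWeight n ht) (tendsto_neg_gammaTail n)]
  ring

theorem gammaTail_zero_right (n : ℕ) : gammaTail n 0 = 1 := by
  simp [gammaTail, Finset.sum_range_succ']

/-! ### The substitution `u = 1 - e ^ (-y)` -/

theorem recL_one_sub_exp_neg (y : ℝ) : recL (1 - Real.exp (-y)) = y := by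
  simp [recL]

theorem one_sub_exp_neg_recL {u : ℝ} (hu : u < 1) : 1 - Real.exp (-recL u) = u := by
  simp [recL, Real.exp_log (sub_pos.2 hu)]

theorem recL_pos {u : ℝ} (hu : u ∈ Ioo (0 : ℝ) 1) : 0 < recL u := by
  have : Real.log (1 - u) < 0 := Real.log_neg (by linarith [hu.2]) (by linarith [hu.1])
  simpa [recL] using this

theorem one_sub_exp_neg_mem_Ioo {y : ℝ} (hy : 0 < y) : 1 - Real.exp (-y) ∈ Ioo (0 : ℝ) 1 := by
  have h1 : Real.exp (-y) < 1 := by simpa using hy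
  have h2 := Real.exp_pos (-y)
  constructor <;> linarith

theorem image_one_sub_exp_neg : (fun y => 1 - Real.exp (-y)) '' Ioi 0 = Ioo (0 : ℝ) 1 := by
  ext u
  constructor
  · rintro ⟨y, hy, rfl⟩
    exact one_sub_exp_neg_mem_Ioo hy
  · exact fun hu => ⟨recL u, recL_pos hu, one_sub_exp_neg_recL hu.2⟩

theorem recL_le_recL_iff {u v : ℝ} (hu : u < 1) (hv : v < 1) : recL u ≤ recL v ↔ u ≤ v := by
  rw [recL, recL, neg_le_neg_iff, Real.log_le_log_iff (sub_pos.2 hv) (sub_pos.2 hu)]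
  constructor <;> intro h <;> linarith

theorem recL_lt_recL_iff {u v : ℝ} (hu : u < 1) (hv : v < 1) : recL u < recL v ↔ u < v := by
  rw [← not_le, recL_le_recL_iff hv hu, not_le]

theorem measurable_recL : Measurable recL := by
  unfold recL
  fun_prop

theorem continuousAt_recL {u : ℝ} (hu : u < 1) : ContinuousAt recL u := by
  unfold recL
  have h : 1 - u ≠ 0 := by linarith
  fun_prop (disch := assumption)

theorem hasDerivAt_recL {u : ℝ} (hu : u < 1) : HasDerivAt recL (1 - u)⁻¹ u := by
  have h : 1 - u ≠ 0 := by linarith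
  refine (((hasDerivAt_id u).const_sub 1).log h).neg.congr_deriv ?_
  simp [neg_div]

theorem hasDerivAt_one_sub_exp_neg (y : ℝ) :
    HasDerivAt (fun y => 1 - Real.exp (-y)) (Real.exp (-y)) y := by
  simpa using (hasDerivAt_neg y).exp.const_sub 1

theorem injective_one_sub_exp_neg : Function.Injective fun y : ℝ => 1 - Real.exp (-y) :=
  Function.LeftInverse.injective recL_one_sub_exp_neg

theorem integral_Ioo_comp_recL (g : ℝ → ℝ) :
    ∫ u in Ioo (0 : ℝ) 1, g (recL u) = ∫ y in Ioi 0, Real.exp (-y) * g y := by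
  rw [← image_one_sub_exp_neg, integral_image_eq_integral_abs_deriv_smul measurableSet_Ioi
    (fun y _ => (hasDerivAt_one_sub_exp_neg y).hasDerivWithinAt) injective_one_sub_exp_neg.injOn]
  simp [recL_one_sub_exp_neg]

theorem integrableOn_Ioo_comp_recL (g : ℝ → ℝ) :
    IntegrableOn (fun u => g (recL u)) (Ioo (0 : ℝ) 1) ↔
      IntegrableOn (fun y => Real.exp (-y) * g y) (Ioi 0) := by
  rw [← image_one_sub_exp_neg, integrableOn_image_iff_integrableOn_abs_deriv_smul measurableSet_Ioi
    (fun y _ => (hasDerivAt_one_sub_exp_neg y).hasDerivWithinAt) injective_one_sub_exp_neg.injOn]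
  simp [recL_one_sub_exp_neg]

/-! ### The function `H` with `stieltjesG lam u = H (recL u)` -/

/-- The derivative of `stieltjesH lam`. -/
noncomputable def stieltjesSlope (lam y : ℝ) : ℝ := Real.exp y / y * stieltjesPdf lam y

/-- The additive constant in `stieltjesG`. -/
noncomputable def stieltjesConst (lam : ℝ) : ℝ :=
  (∫ t in (0 : ℝ)..1, (Real.exp t - 1) / t * stieltjesPdf lam t)
    - ∫ t in Ioi (1 : ℝ), 1 / t * stieltjesPdf lam t

/-- The function `H` on `(0,∞)` for which `stieltjesG lam u = H (recL u)`. -/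
noncomputable def stieltjesH (lam y : ℝ) : ℝ :=
  (∫ t in (1 : ℝ)..y, stieltjesSlope lam t) + stieltjesConst lam

theorem stieltjesG_eq (lam u : ℝ) : stieltjesG lam u = stieltjesH lam (recL u) :=
  add_sub_assoc _ _ _

theorem measurable_stieltjesSlope (lam : ℝ) : Measurable (stieltjesSlope lam) :=
  (Real.measurable_exp.div measurable_id).mul (measurable_stieltjesPdf lam)

theorem stieltjesSlope_nonneg {lam : ℝ} (hlam : lam ∈ Icc (-1 : ℝ) 1) {y : ℝ} (hy : 0 < y) :
    0 ≤ stieltjesSlope lam y :=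
  mul_nonneg (by positivity) (stieltjesPdf_nonneg hlam hy)

theorem continuousAt_stieltjesSlope (lam : ℝ) {y : ℝ} (hy : 0 < y) :
    ContinuousAt (stieltjesSlope lam) y :=
  (Real.continuous_exp.continuousAt.div continuousAt_id hy.ne').mul
    (continuousAt_stieltjesPdf lam hy)

theorem intervalIntegrable_stieltjesSlope (lam : ℝ) {a b : ℝ} (ha : 0 < a) (hb : 0 < b) :
    IntervalIntegrable (stieltjesSlope lam) volume a b :=
  ContinuousOn.intervalIntegrable fun _ hy =>
    (continuousAt_stieltjesSlope lam (lt_of_lt_of_le (lt_min ha hb) hy.1)).continuousWithinAt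

theorem stieltjesH_sub (lam : ℝ) {a b : ℝ} (ha : 0 < a) (hb : 0 < b) :
    stieltjesH lam b - stieltjesH lam a = ∫ y in a..b, stieltjesSlope lam y := by
  rw [stieltjesH, stieltjesH, add_sub_add_right_eq_sub,
    intervalIntegral.integral_interval_sub_left (intervalIntegrable_stieltjesSlope lam one_pos hb)
      (intervalIntegrable_stieltjesSlope lam one_pos ha)]

theorem hasDerivAt_stieltjesH (lam : ℝ) {y : ℝ} (hy : 0 < y) :
    HasDerivAt (stieltjesH lam) (stieltjesSlope lam y) y :=
  (intervalIntegral.integral_hasDerivAt_right (intervalIntegrable_stieltjesSlope lam one_pos hy)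
    (measurable_stieltjesSlope lam).stronglyMeasurable.stronglyMeasurableAtFilter
    (continuousAt_stieltjesSlope lam hy)).add_const _

theorem countable_stieltjesSlope_eq_zero {lam : ℝ} (hlam : lam ∈ Icc (-1 : ℝ) 1) :
    {y ∈ Ioi (0 : ℝ) | stieltjesSlope lam y = 0}.Countable := by
  refine (countable_stieltjesPdf_eq_zero hlam).mono ?_
  rintro y ⟨hy, h⟩
  have hy : 0 < y := hy
  exact ⟨hy, (mul_eq_zero.1 h).resolve_left (by positivity)⟩

/-- At `λ = ±1` the slope does vanish, but only on a countable set, so its integral over any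
nondegenerate interval is still positive. -/
theorem strictMonoOn_stieltjesH {lam : ℝ} (hlam : lam ∈ Icc (-1 : ℝ) 1) :
    StrictMonoOn (stieltjesH lam) (Ioi 0) := by
  intro a ha b hb hab
  have ha : 0 < a := ha
  have hb : 0 < b := hb
  rw [← sub_pos, stieltjesH_sub lam ha hb]
  rw [intervalIntegral.integral_pos_iff_support_of_nonneg_ae' _
    (intervalIntegrable_stieltjesSlope lam ha hb)]
  · refine ⟨hab, ?_⟩
    have h : Ioc a b \ {y ∈ Ioi (0 : ℝ) | stieltjesSlope lam y = 0} ⊆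
        Function.support (stieltjesSlope lam) ∩ Ioc a b :=
      fun y hy => ⟨fun h0 => hy.2 ⟨ha.trans hy.1.1, h0⟩, hy.1⟩
    refine lt_of_lt_of_le ?_ (measure_mono h)
    rw [measure_sdiff_null ((countable_stieltjesSlope_eq_zero hlam).measure_zero _)]
    simpa using hab
  · rw [uIoc_of_le hab.le]
    filter_upwards [ae_restrict_mem measurableSet_Ioc] with y hy
    exact stieltjesSlope_nonneg hlam (ha.trans hy.1)

/-! ### The moments of `stieltjesH` against the Gamma densities -/

theorem integrableOn_one_div_mul_stieltjesPdf (lam : ℝ) :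
    IntegrableOn (fun t => 1 / t * stieltjesPdf lam t) (Ioi 1) := by
  refine ((integrableOn_stieltjesPdf lam).mono_set (Ioi_subset_Ioi zero_le_one)).bdd_mul (c := 1)
    (by fun_prop) ?_
  filter_upwards [ae_restrict_mem measurableSet_Ioi] with t ht
  have ht : 1 < t := ht
  rw [Real.norm_of_nonneg (by positivity), div_le_one (by linarith)]
  exact ht.le

/-- Multiply `1 - t ≤ e^(-t)` by `e^t`. This bounds the first integrand of `stieltjesConst` near
`0`. -/
theorem exp_sub_one_div_le {t : ℝ} (ht : 0 < t) : (Real.exp t - 1) / t ≤ Real.exp t := by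
  rw [div_le_iff₀ ht]
  have h := Real.add_one_le_exp (-t)
  have h2 : Real.exp t * Real.exp (-t) = 1 := by rw [← Real.exp_add]; simp
  nlinarith [Real.exp_pos t]

theorem integrableOn_exp_sub_one_div_mul_stieltjesPdf (lam : ℝ) :
    IntegrableOn (fun t => (Real.exp t - 1) / t * stieltjesPdf lam t) (Ioc 0 1) := by
  refine ((integrableOn_stieltjesPdf lam).mono_set Ioc_subset_Ioi_self).bdd_mul (c := Real.exp 1)
    ((Real.measurable_exp.sub_const 1).div measurable_id).aestronglyMeasurable ?_
  filter_upwards [ae_restrict_mem measurableSet_Ioc] with t ht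
  have h0 : 0 ≤ Real.exp t - 1 := by linarith [Real.add_one_le_exp t, ht.1]
  rw [Real.norm_of_nonneg (div_nonneg h0 ht.1.le)]
  exact (exp_sub_one_div_le ht.1).trans (Real.exp_le_exp.2 ht.2)

theorem stieltjesSlope_mul_gammaTail_zero_of_one_lt (lam : ℝ) {t : ℝ} (ht : 1 < t) :
    stieltjesSlope lam t * (gammaTail 0 t - if t ≤ 1 then 1 else 0) =
      1 / t * stieltjesPdf lam t := by
  have h2 : Real.exp t * Real.exp (-t) = 1 := by rw [← Real.exp_add]; simp
  simp only [stieltjesSlope, gammaTail, not_le.2 ht, if_false]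
  simp
  linear_combination t⁻¹ * stieltjesPdf lam t * h2

theorem stieltjesSlope_mul_gammaTail_zero_of_le_one (lam : ℝ) {t : ℝ} (ht : t ≤ 1) :
    stieltjesSlope lam t * (gammaTail 0 t - if t ≤ 1 then 1 else 0) =
      -((Real.exp t - 1) / t * stieltjesPdf lam t) := by
  have h2 : Real.exp t * Real.exp (-t) = 1 := by rw [← Real.exp_add]; simp
  simp only [stieltjesSlope, gammaTail, ht, if_true]
  simp
  linear_combination t⁻¹ * stieltjesPdf lam t * h2

theorem integrableOn_stieltjesSlope_mul_gammaTail_zero (lam : ℝ) :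
    IntegrableOn (fun t => stieltjesSlope lam t * (gammaTail 0 t - if t ≤ 1 then 1 else 0))
      (Ioi 0) := by
  rw [← Ioc_union_Ioi_eq_Ioi zero_le_one]
  refine IntegrableOn.union ?_ ?_
  · exact (integrableOn_exp_sub_one_div_mul_stieltjesPdf lam).neg.congr_fun
      (fun t ht => (stieltjesSlope_mul_gammaTail_zero_of_le_one lam ht.2).symm) measurableSet_Ioc
  · exact (integrableOn_one_div_mul_stieltjesPdf lam).congr_fun
      (fun t ht => (stieltjesSlope_mul_gammaTail_zero_of_one_lt lam ht).symm) measurableSet_Ioi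

/-- The ranges `t ≤ 1` and `t > 1` give exactly the two integrals in `stieltjesConst`; that constant
is what makes `stieltjesH` centred under `e^(-y)`. -/
theorem integral_stieltjesSlope_mul_gammaTail_zero (lam : ℝ) :
    ∫ t in Ioi 0, stieltjesSlope lam t * (gammaTail 0 t - if t ≤ 1 then 1 else 0) =
      -stieltjesConst lam := by
  have h := integrableOn_stieltjesSlope_mul_gammaTail_zero lam
  rw [← Ioc_union_Ioi_eq_Ioi zero_le_one] at h ⊢
  rw [setIntegral_union (Ioc_disjoint_Ioi le_rfl) measurableSet_Ioi h.left_of_union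
    h.right_of_union,
    setIntegral_congr_fun measurableSet_Ioc
      (fun t ht => stieltjesSlope_mul_gammaTail_zero_of_le_one lam ht.2),
    setIntegral_congr_fun measurableSet_Ioi
      (fun t ht => stieltjesSlope_mul_gammaTail_zero_of_one_lt lam ht), integral_neg,
    stieltjesConst, intervalIntegral.integral_of_le zero_le_one]
  ring

/-- The factor `e^t / t` cancels against `e^(-t) t^(j+1) / (j+1)!`, so beyond the zeroth tail only
monomials times the density remain. -/
theorem stieltjesSlope_mul_gammaTail (lam : ℝ) (n : ℕ) {t : ℝ} (ht : 0 < t) :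
    stieltjesSlope lam t * (gammaTail n t - if t ≤ 1 then 1 else 0) =
      stieltjesSlope lam t * (gammaTail 0 t - if t ≤ 1 then 1 else 0) +
        ∑ j ∈ Finset.range n, ((j + 1).factorial : ℝ)⁻¹ * (t ^ j * stieltjesPdf lam t) := by
  have h2 : Real.exp t * Real.exp (-t) = 1 := by rw [← Real.exp_add]; simp
  have h3 : gammaTail n t = gammaTail 0 t +
      Real.exp (-t) * (t * ∑ j ∈ Finset.range n, ((j + 1).factorial : ℝ)⁻¹ * t ^ j) := by
    have h5 : ∑ j ∈ Finset.range n, t ^ (j + 1) / ((j + 1).factorial : ℝ) =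
        t * ∑ j ∈ Finset.range n, ((j + 1).factorial : ℝ)⁻¹ * t ^ j := by
      rw [Finset.mul_sum]
      refine Finset.sum_congr rfl fun j _ => ?_
      rw [pow_succ]
      ring
    rw [gammaTail, gammaTail, Finset.sum_range_succ', h5]
    simp
    ring
  have h4 : ∑ j ∈ Finset.range n, ((j + 1).factorial : ℝ)⁻¹ * (t ^ j * stieltjesPdf lam t) =
      (∑ j ∈ Finset.range n, ((j + 1).factorial : ℝ)⁻¹ * t ^ j) * stieltjesPdf lam t := by
    rw [Finset.sum_mul]
    exact Finset.sum_congr rfl (fun j _ => (mul_assoc _ _ _).symm)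
  rw [h4, h3, stieltjesSlope]
  generalize ∑ j ∈ Finset.range n, ((j + 1).factorial : ℝ)⁻¹ * t ^ j = S
  field_simp
  linear_combination t * S * h2 * stieltjesPdf lam t

theorem integrableOn_stieltjesSlope_mul_gammaTail (lam : ℝ) (n : ℕ) :
    IntegrableOn (fun t => stieltjesSlope lam t * (gammaTail n t - if t ≤ 1 then 1 else 0))
      (Ioi 0) := by
  have h : IntegrableOn (fun t => ∑ j ∈ Finset.range n,
      ((j + 1).factorial : ℝ)⁻¹ * (t ^ j * stieltjesPdf lam t)) (Ioi 0) :=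
    integrable_finsetSum _ fun j _ => (integrableOn_pow_mul_stieltjesPdf lam j).const_mul _
  exact ((integrableOn_stieltjesSlope_mul_gammaTail_zero lam).add h).congr_fun
    (fun t ht => (stieltjesSlope_mul_gammaTail lam n ht).symm) measurableSet_Ioi

theorem integral_stieltjesSlope_mul_gammaTail (lam : ℝ) (n : ℕ) :
    ∫ t in Ioi 0, stieltjesSlope lam t * (gammaTail n t - if t ≤ 1 then 1 else 0) =
      -stieltjesConst lam + ∑ k ∈ Finset.range n,
        Real.exp ((k : ℝ) ^ 2 / 2) / ((k + 1).factorial : ℝ) := by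
  have hj : ∀ j ∈ Finset.range n, IntegrableOn
      (fun t => ((j + 1).factorial : ℝ)⁻¹ * (t ^ j * stieltjesPdf lam t)) (Ioi 0) :=
    fun j _ => (integrableOn_pow_mul_stieltjesPdf lam j).const_mul _
  rw [setIntegral_congr_fun measurableSet_Ioi
    (fun t ht => stieltjesSlope_mul_gammaTail lam n ht),
    integral_add (integrableOn_stieltjesSlope_mul_gammaTail_zero lam) (integrable_finsetSum _ hj),
    integral_stieltjesSlope_mul_gammaTail_zero, integral_finsetSum _ hj]
  simp only [integral_const_mul, integral_pow_mul_stieltjesPdf, div_eq_inv_mul]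

theorem integrableOn_gammaWeight_mul_stieltjesH_and_integral (lam : ℝ) (n : ℕ) :
    IntegrableOn (fun y => gammaWeight n y * stieltjesH lam y) (Ioi 0) ∧
      ∫ y in Ioi 0, gammaWeight n y * stieltjesH lam y =
        ∑ k ∈ Finset.range n, Real.exp ((k : ℝ) ^ 2 / 2) / ((k + 1).factorial : ℝ) := by
  have htot : ∫ y in Ioi 0, gammaWeight n y = 1 := by
    rw [integral_Ioi_gammaWeight n le_rfl, gammaTail_zero_right]
  obtain ⟨h1, h2⟩ := integrableOn_mul_intervalIntegral (measurable_gammaWeight n)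
    (measurable_stieltjesSlope lam) (fun y hy => gammaWeight_nonneg n hy.le)
    (integrableOn_gammaWeight n le_rfl) htot (fun t ht => integral_Ioi_gammaWeight n ht.le)
    (integrableOn_stieltjesSlope_mul_gammaTail lam n)
  have h3 := (integrableOn_gammaWeight n le_rfl).mul_const (stieltjesConst lam)
  simp only [stieltjesH, mul_add]
  refine ⟨h1.add h3, ?_⟩
  rw [integral_add h1 h3, h2, integral_mul_const, htot, integral_stieltjesSlope_mul_gammaTail]
  ring

/-- The normalisations are the Gamma moments for `n = 0` (empty sum) and `n = 1` (the single term
`e^0 / 1!`). -/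
theorem isHZeroFun_stieltjesH {lam : ℝ} (hlam : lam ∈ Icc (-1 : ℝ) 1) :
    IsHZeroFun (stieltjesH lam) where
  nonconst := ⟨1, mem_Ioi.2 one_pos, 2, mem_Ioi.2 two_pos,
    (strictMonoOn_stieltjesH hlam (mem_Ioi.2 one_pos) (mem_Ioi.2 two_pos) one_lt_two).ne⟩
  mono := (strictMonoOn_stieltjesH hlam).monotoneOn
  leftCont := fun y hy => (hasDerivAt_stieltjesH lam hy).continuousAt.continuousWithinAt
  integrable := fun m => by
    have h := ((integrableOn_gammaWeight_mul_stieltjesH_and_integral lam m).1.const_mul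
      (m.factorial : ℝ)).norm
    refine h.congr ?_
    filter_upwards [ae_restrict_mem measurableSet_Ioi] with y hy
    have hy : 0 < y := hy
    have hm : (m.factorial : ℝ) ≠ 0 := by positivity
    have e : (m.factorial : ℝ) * (gammaWeight m y * stieltjesH lam y) =
        y ^ m * Real.exp (-y) * stieltjesH lam y := by
      rw [gammaWeight]
      field_simp
    rw [e, norm_mul, Real.norm_of_nonneg (by positivity), Real.norm_eq_abs]
  int_zero := by
    simpa [gammaWeight] using (integrableOn_gammaWeight_mul_stieltjesH_and_integral lam 0).2
  int_one := by
    simpa [gammaWeight] using (integrableOn_gammaWeight_mul_stieltjesH_and_integral lam 1).2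

theorem integrableOn_recL_pow_mul_stieltjesG (lam : ℝ) (n : ℕ) :
    IntegrableOn (fun u => recL u ^ n / (n.factorial : ℝ) * stieltjesG lam u) (Ioo 0 1) := by
  simp only [stieltjesG_eq]
  rw [integrableOn_Ioo_comp_recL (fun y => y ^ n / (n.factorial : ℝ) * stieltjesH lam y)]
  simpa only [gammaWeight, mul_assoc, mul_left_comm] using
    (integrableOn_gammaWeight_mul_stieltjesH_and_integral lam n).1

theorem integral_recL_pow_mul_stieltjesG (lam : ℝ) (n : ℕ) :
    ∫ u in Ioo (0 : ℝ) 1, recL u ^ n / (n.factorial : ℝ) * stieltjesG lam u =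
      ∑ k ∈ Finset.range n, Real.exp ((k : ℝ) ^ 2 / 2) / ((k + 1).factorial : ℝ) := by
  simp only [stieltjesG_eq]
  rw [integral_Ioo_comp_recL (fun y => y ^ n / (n.factorial : ℝ) * stieltjesH lam y)]
  simpa only [gammaWeight, mul_assoc, mul_left_comm] using
    (integrableOn_gammaWeight_mul_stieltjesH_and_integral lam n).2

/-! ### Inverse distribution functions -/

/-- The Galois connection between a distribution function and its quantile function. Right
continuity of the former makes the infimum attained. -/
theorem le_cdf_iff_invCdf_le (μ : Measure ℝ) {u : ℝ} (hu : u ∈ Ioo (0 : ℝ) 1) (x : ℝ) :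
    u ≤ cdf μ x ↔ invCdf μ u ≤ x := by
  have hne : {x : ℝ | u ≤ cdf μ x}.Nonempty := by
    obtain ⟨x, hx⟩ := ((tendsto_cdf_atTop μ).eventually (lt_mem_nhds hu.2)).exists
    exact ⟨x, hx.le⟩
  have hbdd : BddBelow {x : ℝ | u ≤ cdf μ x} := by
    obtain ⟨b, hb⟩ := ((tendsto_cdf_atBot μ).eventually (gt_mem_nhds hu.1)).exists
    refine ⟨b, fun x hx => ?_⟩
    by_contra h
    exact absurd (hx.trans (monotone_cdf μ (not_le.1 h).le)) (not_le.2 hb)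
  have hmem : u ≤ cdf μ (invCdf μ u) := by
    have h1 : Filter.Tendsto (cdf μ) (nhdsWithin (invCdf μ u) (Ioi (invCdf μ u)))
        (nhds (cdf μ (invCdf μ u))) :=
      ((cdf μ).right_continuous _).mono_left (nhdsWithin_mono _ Ioi_subset_Ici_self)
    refine ge_of_tendsto h1 ?_
    filter_upwards [self_mem_nhdsWithin] with y hy
    obtain ⟨s, hs, hsy⟩ := exists_lt_of_csInf_lt hne hy
    exact le_trans hs (monotone_cdf μ hsy.le)
  exact ⟨fun h => csInf_le hbdd h, fun h => hmem.trans (monotone_cdf μ h)⟩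

theorem eq_of_invCdf_eq (μ ν : Measure ℝ) [IsProbabilityMeasure μ] [IsProbabilityMeasure ν]
    (h : ∀ u ∈ Ioo (0 : ℝ) 1, invCdf μ u = invCdf ν u) : μ = ν := by
  have key : ∀ (μ ν : Measure ℝ), (∀ u ∈ Ioo (0 : ℝ) 1, invCdf μ u = invCdf ν u) → ∀ x,
      cdf μ x ≤ cdf ν x := by
    intro μ ν h x
    refine le_of_forall_lt_imp_le_of_dense fun c hc => ?_
    rcases le_or_gt c 0 with h0 | h0
    · exact h0.trans (cdf_nonneg ν x)
    · have hc1 : c ∈ Ioo (0 : ℝ) 1 := ⟨h0, hc.trans_le (cdf_le_one μ x)⟩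
      rw [le_cdf_iff_invCdf_le ν hc1, ← h c hc1, ← le_cdf_iff_invCdf_le μ hc1]
      exact hc.le
  refine Measure.eq_of_cdf μ ν (StieltjesFunction.ext fun x => ?_)
  exact le_antisymm (key μ ν h x) (key ν μ (fun u hu => (h u hu).symm) x)

theorem invCdf_map_unif {g : ℝ → ℝ} (hg : MonotoneOn g (Ioo 0 1))
    (hc : ContinuousOn g (Ioo 0 1)) {u : ℝ} (hu : u ∈ Ioo (0 : ℝ) 1) :
    invCdf (unif.map g) u = g u := by
  have hm : AEMeasurable g unif := hc.aemeasurable measurableSet_Ioo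
  have := Measure.isProbabilityMeasure_map (μ := unif) hm
  have hcdf : ∀ x, ENNReal.ofReal (cdf (unif.map g) x) = volume (g ⁻¹' Iic x ∩ Ioo 0 1) := by
    intro x
    rw [ofReal_cdf, Measure.map_apply_of_aemeasurable hm measurableSet_Iic, unif,
      Measure.restrict_apply' measurableSet_Ioo]
  have hset : {x : ℝ | u ≤ cdf (unif.map g) x} = Ici (g u) := by
    ext x
    rw [mem_ofPred_eq, mem_Ici, ← ENNReal.ofReal_le_ofReal_iff (cdf_nonneg _ x), hcdf]
    constructor
    · intro h
      by_contra hx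
      have hx := not_lt.1 (fun h' => hx (le_of_lt h')) |>.lt_of_ne (fun h' => hx h'.ge)
      -- If `x < g u`, continuity gives `v < u` with `x < g v`; the event `g ≤ x` then lies in `(0,
      -- v)` and has mass less than `u`.
      have h1 : ∀ᶠ v in nhdsWithin u (Iio u), x < g v :=
        ((hc.continuousAt (Ioo_mem_nhds hu.1 hu.2)).eventually
          (lt_mem_nhds hx)).filter_mono nhdsWithin_le_nhds
      obtain ⟨v, hv, hv'⟩ := (h1.and (Ioo_mem_nhdsLT hu.1)).exists
      have h2 : g ⁻¹' Iic x ∩ Ioo 0 1 ⊆ Ioo 0 v := by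
        rintro w ⟨hw, hw'⟩
        refine ⟨hw'.1, ?_⟩
        by_contra hvw
        exact absurd (hv.trans_le (hg ⟨hv'.1, hv'.2.trans hu.2⟩ hw' (not_lt.1 hvw)))
          (not_lt.2 hw)
      have h3 := h.trans (measure_mono h2)
      rw [Real.volume_Ioo, sub_zero, ENNReal.ofReal_le_ofReal_iff hv'.1.le] at h3
      exact absurd hv'.2 (not_lt.2 h3)
    · intro h
      have h2 : Ioc 0 u ⊆ g ⁻¹' Iic x ∩ Ioo 0 1 := fun w hw =>
        have hw' : w ∈ Ioo (0 : ℝ) 1 := ⟨hw.1, hw.2.trans_lt hu.2⟩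
        ⟨(hg hw' hu hw.2).trans h, hw'⟩
      simpa using measure_mono (μ := volume) h2
  rw [invCdf, hset, csInf_Ici]

/-! ### The laws `X_λ` -/

/-- The law with inverse distribution function `stieltjesG lam`. -/
noncomputable def stieltjesX (lam : ℝ) : Measure ℝ := unif.map (stieltjesG lam)

theorem strictMonoOn_stieltjesG {lam : ℝ} (hlam : lam ∈ Icc (-1 : ℝ) 1) :
    StrictMonoOn (stieltjesG lam) (Ioo 0 1) := by
  intro u hu v hv huv
  rw [stieltjesG_eq, stieltjesG_eq]
  exact strictMonoOn_stieltjesH hlam (recL_pos hu) (recL_pos hv) ((recL_lt_recL_iff hu.2 hv.2).2 huv)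

theorem continuousOn_stieltjesG (lam : ℝ) : ContinuousOn (stieltjesG lam) (Ioo 0 1) := by
  intro u hu
  rw [show stieltjesG lam = stieltjesH lam ∘ recL from funext (stieltjesG_eq lam)]
  exact ((hasDerivAt_stieltjesH lam (recL_pos hu)).continuousAt.comp
    (continuousAt_recL hu.2)).continuousWithinAt

theorem aemeasurable_stieltjesG (lam : ℝ) : AEMeasurable (stieltjesG lam) unif :=
  (continuousOn_stieltjesG lam).aemeasurable measurableSet_Ioo

instance (lam : ℝ) : IsProbabilityMeasure (stieltjesX lam) :=
  Measure.isProbabilityMeasure_map (aemeasurable_stieltjesG lam)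

theorem invCdf_stieltjesX {lam : ℝ} (hlam : lam ∈ Icc (-1 : ℝ) 1) {u : ℝ}
    (hu : u ∈ Ioo (0 : ℝ) 1) : invCdf (stieltjesX lam) u = stieltjesG lam u :=
  invCdf_map_unif (strictMonoOn_stieltjesG hlam).monotoneOn (continuousOn_stieltjesG lam) hu

theorem stieltjesX_mem_HZero {lam : ℝ} (hlam : lam ∈ Icc (-1 : ℝ) 1) :
    stieltjesX lam ∈ HZero :=
  ⟨inferInstance, stieltjesH lam, isHZeroFun_stieltjesH hlam, fun u hu => by
    rw [invCdf_stieltjesX hlam hu, stieltjesG_eq]⟩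

theorem continuousOn_stieltjesH (lam : ℝ) : ContinuousOn (stieltjesH lam) (Ioi 0) :=
  fun _ hy => (hasDerivAt_stieltjesH lam hy).continuousAt.continuousWithinAt

/-- The slope is nonzero off a countable set, so by the change of variables formula `stieltjesH`
pulls null sets back to null sets; the differentiable map `y ↦ 1 - e^(-y)` then carries these to
null sets of `(0,1)`. -/
theorem stieltjesX_absolutelyContinuous {lam : ℝ} (hlam : lam ∈ Icc (-1 : ℝ) 1) :
    stieltjesX lam ≪ volume := by
  classical
  refine Measure.AbsolutelyContinuous.mk fun N hN h0 => ?_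
  have hS : MeasurableSet (Ioi 0 ∩ stieltjesH lam ⁻¹' N) := by
    have hm : Measurable ((Ioi (0 : ℝ)).piecewise (stieltjesH lam) 0) :=
      (continuousOn_stieltjesH lam).measurable_piecewise continuousOn_const measurableSet_Ioi
    have : Ioi 0 ∩ stieltjesH lam ⁻¹' N =
        Ioi 0 ∩ ((Ioi (0 : ℝ)).piecewise (stieltjesH lam) 0) ⁻¹' N := by
      ext y
      refine and_congr_right fun hy => ?_
      rw [mem_preimage, mem_preimage, piecewise_eq_of_mem _ _ _ hy]
    rw [this]
    exact measurableSet_Ioi.inter (hm hN)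
  have h1 := lintegral_image_eq_lintegral_abs_deriv_mul hS
    (fun y hy => (hasDerivAt_stieltjesH lam hy.1).hasDerivWithinAt)
    ((strictMonoOn_stieltjesH hlam).injOn.mono inter_subset_left) 1
  have h2 : volume (Ioi 0 ∩ stieltjesH lam ⁻¹' N) = 0 := by
    have h3 : volume (stieltjesH lam '' (Ioi 0 ∩ stieltjesH lam ⁻¹' N)) = 0 :=
      measure_mono_null (image_subset_iff.2 inter_subset_right) h0
    simp only [Pi.one_apply, lintegral_one, Measure.restrict_apply_univ, h3, mul_one] at h1
    have hma : Measurable fun y => ENNReal.ofReal |stieltjesSlope lam y| :=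
      (measurable_stieltjesSlope lam).norm.ennreal_ofReal
    rw [eq_comm, lintegral_eq_zero_iff hma] at h1
    have h4 : ∀ᵐ y, y ∉ {y ∈ Ioi (0 : ℝ) | stieltjesSlope lam y = 0} :=
      measure_eq_zero_iff_ae_notMem.1 ((countable_stieltjesSlope_eq_zero hlam).measure_zero _)
    rw [measure_eq_zero_iff_ae_notMem]
    filter_upwards [(ae_restrict_iff' hS).1 h1, h4] with y h5 h6 h7
    refine h6 ⟨h7.1, ?_⟩
    simpa using h5 h7
  rw [stieltjesX, Measure.map_apply_of_aemeasurable (aemeasurable_stieltjesG lam) hN, unif,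
    Measure.restrict_apply' measurableSet_Ioo]
  refine measure_mono_null (t := (fun y => 1 - Real.exp (-y)) '' (Ioi 0 ∩ stieltjesH lam ⁻¹' N))
    ?_ (addHaar_image_eq_zero_of_differentiableOn_of_addHaar_eq_zero volume
      (fun y _ => (hasDerivAt_one_sub_exp_neg y).differentiableAt.differentiableWithinAt) h2)
  rintro u ⟨hu, hu'⟩
  refine ⟨recL u, ⟨recL_pos hu', ?_⟩, one_sub_exp_neg_recL hu'.2⟩
  rwa [mem_preimage, ← stieltjesG_eq]

/-- Strict monotonicity of the quantile function excludes atoms, hence jumps of the distribution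
function over `u`. -/
theorem cdf_stieltjesX_stieltjesG {lam : ℝ} (hlam : lam ∈ Icc (-1 : ℝ) 1) {u : ℝ}
    (hu : u ∈ Ioo (0 : ℝ) 1) : cdf (stieltjesX lam) (stieltjesG lam u) = u := by
  refine le_antisymm (le_of_not_gt fun h => ?_) ?_
  · obtain ⟨v, hv⟩ := exists_between (lt_min h hu.2)
    have hv1 : v ∈ Ioo (0 : ℝ) 1 := ⟨hu.1.trans hv.1, hv.2.trans_le (min_le_right _ _)⟩
    have h1 := (le_cdf_iff_invCdf_le (stieltjesX lam) hv1 (stieltjesG lam u)).1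
      (hv.2.le.trans (min_le_left _ _))
    rw [invCdf_stieltjesX hlam hv1] at h1
    exact absurd (strictMonoOn_stieltjesG hlam hu hv1 hv.1) (not_lt.2 h1)
  · rw [le_cdf_iff_invCdf_le _ hu, invCdf_stieltjesX hlam hu]

theorem cdf_stieltjesX_stieltjesH {lam : ℝ} (hlam : lam ∈ Icc (-1 : ℝ) 1) {y : ℝ} (hy : 0 < y) :
    cdf (stieltjesX lam) (stieltjesH lam y) = 1 - Real.exp (-y) := by
  simpa [stieltjesG_eq, recL_one_sub_exp_neg] using
    cdf_stieltjesX_stieltjesG hlam (one_sub_exp_neg_mem_Ioo hy)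

/-- Dually, continuity of the quantile function excludes flat pieces of the distribution function at
levels inside `(0,1)`. -/
theorem stieltjesG_cdf_stieltjesX {lam : ℝ} (hlam : lam ∈ Icc (-1 : ℝ) 1) {x : ℝ}
    (hx : cdf (stieltjesX lam) x ∈ Ioo (0 : ℝ) 1) :
    stieltjesG lam (cdf (stieltjesX lam) x) = x := by
  refine le_antisymm ?_ (le_of_not_gt fun h => ?_)
  · rw [← invCdf_stieltjesX hlam hx, ← le_cdf_iff_invCdf_le _ hx]
  · have h1 : ∀ᶠ v in nhdsWithin (cdf (stieltjesX lam) x) (Ioi (cdf (stieltjesX lam) x)),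
        stieltjesG lam v < x :=
      (((continuousOn_stieltjesG lam).continuousAt (Ioo_mem_nhds hx.1 hx.2)).eventually
        (gt_mem_nhds h)).filter_mono nhdsWithin_le_nhds
    obtain ⟨v, hv, hv'⟩ := (h1.and (Ioo_mem_nhdsGT hx.2)).exists
    have hv1 : v ∈ Ioo (0 : ℝ) 1 := ⟨hx.1.trans hv'.1, hv'.2⟩
    rw [← invCdf_stieltjesX hlam hv1] at hv
    exact absurd ((le_cdf_iff_invCdf_le _ hv1 x).2 hv.le) (not_le.2 hv'.1)

/-- Off the range of `stieltjesH` the distribution function is `0` or `1`. Integrals of the weight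
thus reduce to that range, where `x = H(y)` can be substituted. -/
theorem phiWeight_eq_zero_of_notMem_image {lam : ℝ} (hlam : lam ∈ Icc (-1 : ℝ) 1) {x : ℝ}
    (hx : x ∉ stieltjesH lam '' Ioi 0) : phiWeight (stieltjesX lam) x = 0 := by
  have h : cdf (stieltjesX lam) x ∉ Ioo (0 : ℝ) 1 := fun h =>
    hx ⟨_, recL_pos h, by rw [← stieltjesG_eq, stieltjesG_cdf_stieltjesX hlam h]⟩
  rw [mem_Ioo, not_and_or, not_lt, not_lt] at h
  rcases h with h | h
  · have : cdf (stieltjesX lam) x = 0 := le_antisymm h (cdf_nonneg _ _)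
    simp [phiWeight, recL, this]
  · have : cdf (stieltjesX lam) x = 1 := le_antisymm (cdf_le_one _ _) h
    simp [phiWeight, this]

theorem phiWeight_stieltjesH {lam : ℝ} (hlam : lam ∈ Icc (-1 : ℝ) 1) {y : ℝ} (hy : 0 < y) :
    phiWeight (stieltjesX lam) (stieltjesH lam y) = Real.exp (-y) * y := by
  rw [phiWeight, cdf_stieltjesX_stieltjesH hlam hy, recL_one_sub_exp_neg]
  ring

theorem abs_stieltjesSlope_mul {lam : ℝ} (hlam : lam ∈ Icc (-1 : ℝ) 1) {y : ℝ} (hy : 0 < y) :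
    |stieltjesSlope lam y| * (Real.exp (-y) * y) = stieltjesPdf lam y := by
  rw [abs_of_nonneg (stieltjesSlope_nonneg hlam hy), stieltjesSlope, Real.exp_neg]
  have := (Real.exp_pos y).ne'
  field_simp

theorem measurableSet_image_stieltjesH {lam : ℝ} (hlam : lam ∈ Icc (-1 : ℝ) 1) :
    MeasurableSet (stieltjesH lam '' Ioi 0) :=
  measurableSet_Ioi.image_of_continuousOn_injOn (continuousOn_stieltjesH lam)
    (strictMonoOn_stieltjesH hlam).injOn

theorem integral_phiWeight_stieltjesX {lam : ℝ} (hlam : lam ∈ Icc (-1 : ℝ) 1) :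
    ∫ x, phiWeight (stieltjesX lam) x = 1 := by
  rw [← setIntegral_eq_integral_of_forall_compl_eq_zero
    (fun x hx => phiWeight_eq_zero_of_notMem_image hlam hx),
    integral_image_eq_integral_abs_deriv_smul measurableSet_Ioi
    (fun y hy => (hasDerivAt_stieltjesH lam hy).hasDerivWithinAt)
    (strictMonoOn_stieltjesH hlam).injOn]
  have h : ∀ y ∈ Ioi (0 : ℝ), |stieltjesSlope lam y| • phiWeight (stieltjesX lam)
      (stieltjesH lam y) = y ^ 0 * stieltjesPdf lam y := fun y hy => by
    rw [phiWeight_stieltjesH hlam hy, smul_eq_mul, abs_stieltjesSlope_mul hlam hy, pow_zero,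
      one_mul]
  rw [setIntegral_congr_fun measurableSet_Ioi h, integral_pow_mul_stieltjesPdf]
  simp

theorem measurable_cdf (μ : Measure ℝ) : Measurable (cdf μ) := (monotone_cdf μ).measurable

theorem measurable_phiWeight (μ : Measure ℝ) : Measurable (phiWeight μ) :=
  ((measurable_cdf μ).const_sub 1).mul (measurable_recL.comp (measurable_cdf μ))

/-- Substitute `x = H(y)`: then `L(F(x)) = y`, and the Jacobian times the weight is `f_λ(y)`,
already normalised. -/
theorem phi_stieltjesX {lam : ℝ} (hlam : lam ∈ Icc (-1 : ℝ) 1) :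
    phi (stieltjesX lam) = stieltjesLaw lam := by
  ext B hB
  have hm : Measurable fun x => recL (cdf (stieltjesX lam) x) :=
    measurable_recL.comp (measurable_cdf _)
  rw [phi, Measure.map_apply hm hB, phiV, withDensity_apply _ (hm hB), stieltjesLaw,
    withDensity_apply _ hB, integral_phiWeight_stieltjesX hlam, ← lintegral_indicator (hm hB),
    ← lintegral_indicator hB]
  have hI := measurableSet_image_stieltjesH hlam
  have h1 : ∀ x, ((fun x => recL (cdf (stieltjesX lam) x)) ⁻¹' B).indicator
      (fun x => ENNReal.ofReal (phiWeight (stieltjesX lam) x / 1)) x =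
      (stieltjesH lam '' Ioi 0).indicator
        (((fun x => recL (cdf (stieltjesX lam) x)) ⁻¹' B).indicator
          (fun x => ENNReal.ofReal (phiWeight (stieltjesX lam) x / 1))) x := by
    intro x
    by_cases hx : x ∈ stieltjesH lam '' Ioi 0
    · rw [indicator_of_mem hx]
    · rw [indicator_of_notMem hx]
      simp [phiWeight_eq_zero_of_notMem_image hlam hx]
  rw [lintegral_congr h1, lintegral_indicator hI,
    lintegral_image_eq_lintegral_abs_deriv_mul measurableSet_Ioi
    (fun y hy => (hasDerivAt_stieltjesH lam hy).hasDerivWithinAt)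
    (strictMonoOn_stieltjesH hlam).injOn]
  refine setLIntegral_congr_fun measurableSet_Ioi fun y hy => ?_
  have hy : 0 < y := hy
  have h2 : recL (cdf (stieltjesX lam) (stieltjesH lam y)) = y := by
    rw [cdf_stieltjesX_stieltjesH hlam hy, recL_one_sub_exp_neg]
  by_cases hyB : y ∈ B
  · rw [indicator_of_mem hyB, indicator_of_mem (by simpa [h2] using hyB),
      phiWeight_stieltjesH hlam hy, div_one, ← ENNReal.ofReal_mul (abs_nonneg _),
      abs_stieltjesSlope_mul hlam hy]
  · rw [indicator_of_notMem hyB, indicator_of_notMem (by simpa [h2] using hyB), mul_zero]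

/-! ### Injectivity of `phi` -/

/-- Half-open intervals match the Galois connection exactly, so `H` may have jumps and flat pieces.
-/
theorem recL_cdf_preimage_Ico {μ : Measure ℝ} {H : ℝ → ℝ}
    (hH : ∀ u ∈ Ioo (0 : ℝ) 1, invCdf μ u = H (recL u)) {a b : ℝ} (ha : 0 < a) (hb : 0 < b) :
    (fun x => recL (cdf μ x)) ⁻¹' Ico a b = Ico (H a) (H b) := by
  have key : ∀ {y}, 0 < y → ∀ x, 1 - Real.exp (-y) ≤ cdf μ x ↔ H y ≤ x := fun hy x => by
    rw [le_cdf_iff_invCdf_le μ (one_sub_exp_neg_mem_Ioo hy), hH _ (one_sub_exp_neg_mem_Ioo hy),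
      recL_one_sub_exp_neg]
  ext x
  rw [mem_preimage, mem_Ico, mem_Ico, ← not_le, ← not_le (a := H b), ← key ha, ← key hb]
  rcases (cdf_le_one μ x).lt_or_eq with h | h
  · have e : ∀ {y}, 0 < y → (y ≤ recL (cdf μ x) ↔ 1 - Real.exp (-y) ≤ cdf μ x) := fun {y} hy => by
      rw [← recL_le_recL_iff (one_sub_exp_neg_mem_Ioo hy).2 h, recL_one_sub_exp_neg]
    rw [e ha, e hb]
  -- Here `F(x) = 1` and `L` takes the default value `-log 0 = 0`; such `x` lies in neither set,
  -- being at least `H b`.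
  · have h1 : recL (cdf μ x) = 0 := by simp [recL, h]
    rw [h1, h]
    have := (one_sub_exp_neg_mem_Ioo hb).2.le
    constructor
    · rintro ⟨h2, -⟩
      exact absurd ha (not_lt.2 h2)
    · rintro ⟨-, h2⟩
      exact absurd this h2

/-- At `t = L(F(x))` the factor `e^t / t` is the reciprocal of the weight `(1 - F) L(F)`, so what
remains is a constant times the length of the preimage of `[a, b)`. Thus `phi μ` determines `H` up
to an affine change. -/
theorem setLIntegral_phi {μ : Measure ℝ} {H : ℝ → ℝ}
    (hH : ∀ u ∈ Ioo (0 : ℝ) 1, invCdf μ u = H (recL u)) {a b : ℝ} (ha : 0 < a) (hb : 0 < b) :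
    ∫⁻ t in Ico a b, ENNReal.ofReal (Real.exp t / t) ∂(phi μ) =
      ENNReal.ofReal (∫ y, phiWeight μ y)⁻¹ * ENNReal.ofReal (H b - H a) := by
  have hm : Measurable fun x => recL (cdf μ x) := measurable_recL.comp (measurable_cdf _)
  have hm2 : Measurable fun t : ℝ => ENNReal.ofReal (Real.exp t / t) := by
    exact (Real.measurable_exp.div measurable_id).ennreal_ofReal
  have hm3 : Measurable fun x => ENNReal.ofReal (Real.exp (recL (cdf μ x)) / recL (cdf μ x)) :=
    hm2.comp hm
  rw [phi, setLIntegral_map measurableSet_Ico hm2 hm, phiV,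
    setLIntegral_withDensity_eq_setLIntegral_mul _
      ((measurable_phiWeight μ).div_const _).ennreal_ofReal hm3 (hm measurableSet_Ico)]
  have h : ∀ x ∈ (fun x => recL (cdf μ x)) ⁻¹' Ico a b,
      ((fun x => ENNReal.ofReal (phiWeight μ x / ∫ y, phiWeight μ y)) *
        fun x => ENNReal.ofReal (Real.exp (recL (cdf μ x)) / recL (cdf μ x))) x =
      ENNReal.ofReal (∫ y, phiWeight μ y)⁻¹ := by
    intro x hx
    have h0 : 0 < recL (cdf μ x) := ha.trans_le hx.1
    have h1 : cdf μ x < 1 := (cdf_le_one μ x).lt_of_ne fun h1 => by simp [recL, h1] at h0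
    have h2 : Real.exp (recL (cdf μ x)) = (1 - cdf μ x)⁻¹ := by
      rw [recL, Real.exp_neg, Real.exp_log (sub_pos.2 h1)]
    have h3 : 1 - cdf μ x ≠ 0 := (sub_pos.2 h1).ne'
    rw [Pi.mul_apply, ← ENNReal.ofReal_mul' (by positivity), h2, phiWeight]
    congr 1
    field_simp
  rw [setLIntegral_congr_fun (hm measurableSet_Ico) h, setLIntegral_const,
    recL_cdf_preimage_Ico hH ha hb, Real.volume_Ico]

theorem setLIntegral_stieltjesLaw {lam : ℝ} (hlam : lam ∈ Icc (-1 : ℝ) 1) {a b : ℝ} (ha : 0 < a)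
    (hab : a ≤ b) :
    ∫⁻ t in Ico a b, ENNReal.ofReal (Real.exp t / t) ∂(stieltjesLaw lam) =
      ENNReal.ofReal (stieltjesH lam b - stieltjesH lam a) := by
  have hm2 : Measurable fun t : ℝ => ENNReal.ofReal (Real.exp t / t) := by
    exact (Real.measurable_exp.div measurable_id).ennreal_ofReal
  have hsub : Ico a b ⊆ Ioi 0 := fun t ht => ha.trans_le ht.1
  rw [stieltjesLaw, setLIntegral_withDensity_eq_setLIntegral_mul _
    (measurable_stieltjesPdf lam).ennreal_ofReal hm2 measurableSet_Ico,
    Measure.restrict_restrict measurableSet_Ico, inter_eq_left.2 hsub]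
  have h : ∀ t ∈ Ico a b, ((fun t => ENNReal.ofReal (stieltjesPdf lam t)) *
      fun t : ℝ => ENNReal.ofReal (Real.exp t / t)) t = ENNReal.ofReal (stieltjesSlope lam t) := by
    intro t ht
    rw [Pi.mul_apply, ← ENNReal.ofReal_mul (stieltjesPdf_nonneg hlam (hsub ht)), mul_comm,
      stieltjesSlope]
  rw [setLIntegral_congr_fun measurableSet_Ico h, restrict_Ico_eq_restrict_Ioc,
    stieltjesH_sub lam ha (ha.trans_le hab), intervalIntegral.integral_of_le hab,
    ofReal_integral_eq_lintegral_ofReal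
      (intervalIntegrable_stieltjesSlope lam ha (ha.trans_le hab)).1]
  filter_upwards [ae_restrict_mem measurableSet_Ioc] with t ht
  exact stieltjesSlope_nonneg hlam (ha.trans ht.1)

theorem eq_stieltjesX_of_phi_eq {lam : ℝ} (hlam : lam ∈ Icc (-1 : ℝ) 1) {μ : Measure ℝ}
    (hμ : μ ∈ HZero) (h : phi μ = stieltjesLaw lam) : μ = stieltjesX lam := by
  obtain ⟨hp, H, hH, hinv⟩ := hμ
  set c := ∫ y, phiWeight μ y with hc
  have hmono := strictMonoOn_stieltjesH hlam
  have hc0 : 0 ≤ c := by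
    refine integral_nonneg fun x => mul_nonneg (sub_nonneg.2 (cdf_le_one μ x)) ?_
    exact neg_nonneg.2 (Real.log_nonpos (sub_nonneg.2 (cdf_le_one μ x))
      (by linarith [cdf_nonneg μ x]))
  have hinc : ∀ a b, 0 < a → a ≤ b →
      c⁻¹ * (H b - H a) = stieltjesH lam b - stieltjesH lam a := by
    intro a b ha hab
    have hb := ha.trans_le hab
    have e := setLIntegral_phi hinv ha hb
    rw [h, setLIntegral_stieltjesLaw hlam ha hab, ← hc,
      ← ENNReal.ofReal_mul (inv_nonneg.2 hc0)] at e
    exact ((ENNReal.ofReal_eq_ofReal_iff (sub_nonneg.2 (hmono.monotoneOn ha hb hab))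
      (mul_nonneg (inv_nonneg.2 hc0) (sub_nonneg.2 (hH.mono ha hb hab)))).1 e).symm
  -- The Bochner integral `c` could be `0` by default; then `c⁻¹ = 0` would force `stieltjesH` to
  -- have zero increments.
  have hcne : c ≠ 0 := by
    intro h0
    have h1 := hinc 1 2 one_pos one_le_two
    rw [h0, inv_zero, zero_mul] at h1
    linarith [hmono (mem_Ioi.2 one_pos) (mem_Ioi.2 two_pos) one_lt_two]
  set d := H 1 - c * stieltjesH lam 1 with hd
  have haff : ∀ y ∈ Ioi (0 : ℝ), H y = c * stieltjesH lam y + d := by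
    intro y hy
    rcases le_total 1 y with h1 | h1
    · have e := hinc 1 y one_pos h1
      field_simp at e
      linear_combination e + hd
    · have e := hinc y 1 hy h1
      field_simp at e
      linear_combination -e + hd
  have hw : ∀ n, ∫ y in Ioi 0, gammaWeight n y * H y =
      c * (∑ k ∈ Finset.range n, Real.exp ((k : ℝ) ^ 2 / 2) / ((k + 1).factorial : ℝ)) + d := by
    intro n
    obtain ⟨h1, h2⟩ := integrableOn_gammaWeight_mul_stieltjesH_and_integral lam n
    have e : ∀ y ∈ Ioi (0 : ℝ), gammaWeight n y * H y =
        c * (gammaWeight n y * stieltjesH lam y) + gammaWeight n y * d := fun y hy => by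
      rw [haff y hy]
      ring
    rw [setIntegral_congr_fun measurableSet_Ioi e, integral_add (h1.const_mul c)
      ((integrableOn_gammaWeight n le_rfl).mul_const d), integral_const_mul, integral_mul_const, h2,
      integral_Ioi_gammaWeight n le_rfl, gammaTail_zero_right, one_mul]
  have hd0 : d = 0 := by
    have := hw 0
    simp [gammaWeight, hH.int_zero] at this
    linarith
  have hc1 : c = 1 := by
    have := hw 1
    simp [gammaWeight, hH.int_one, hd0] at this
    linarith
  refine eq_of_invCdf_eq _ _ fun u hu => ?_
  rw [hinv u hu, invCdf_stieltjesX hlam hu, stieltjesG_eq, haff _ (recL_pos hu), hc1, hd0]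
  ring

/-! ### Resampling one coordinate -/

instance : IsProbabilityMeasure unifSeq := by
  unfold unifSeq
  infer_instance

theorem measurable_update_prod (j : ℕ) :
    Measurable fun p : (ℕ → ℝ) × ℝ => Function.update p.1 j p.2 := by
  refine measurable_pi_lambda _ fun i => ?_
  by_cases h : i = j
  · subst h
    simpa using measurable_snd
  · simp only [Function.update_of_ne h]
    exact (measurable_pi_apply i).comp measurable_fst

/-- Checked on finite boxes: the preimage is a box without the constraint at `j`, times that
constraint on the fresh variable. -/
theorem map_update_unifSeq (j : ℕ) :
    (unifSeq.prod unif).map (fun p => Function.update p.1 j p.2) = unifSeq := by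
  classical
  refine Measure.eq_infinitePi (μ := fun _ => unif) fun s t ht => ?_
  rw [Measure.map_apply (measurable_update_prod j)
    (MeasurableSet.pi s.countable_toSet fun i _ => ht i)]
  have e : (fun p : (ℕ → ℝ) × ℝ => Function.update p.1 j p.2) ⁻¹' Set.pi s t =
      Set.pi (s.erase j) t ×ˢ (if j ∈ s then t j else univ) := by
    ext ⟨x, r⟩
    simp only [mem_preimage, Set.mem_pi, mem_prod, Finset.coe_erase, mem_sdiff, mem_singleton_iff,
      Finset.mem_coe]
    constructor
    · intro h
      refine ⟨fun i hi => by simpa [Function.update_of_ne hi.2] using h i hi.1, ?_⟩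
      split_ifs with hj
      · simpa using h j hj
      · trivial
    · rintro ⟨h1, h2⟩ i hi
      by_cases hij : i = j
      · subst hij
        simpa [hi] using h2
      · simpa [Function.update_of_ne hij] using h1 i ⟨hi, hij⟩
  rw [e, Measure.prod_prod, unifSeq, Measure.infinitePi_pi _ fun i _ => ht i]
  split_ifs with hj
  · rw [Finset.prod_erase_mul _ _ hj]
  · rw [measure_univ, mul_one, Finset.erase_eq_of_notMem hj]

/-- If `ψ x s` does not depend on the coordinate `x j`, then this coordinate can be integrated out
first. -/
theorem lintegral_unifSeq_resample (j : ℕ) {ψ : (ℕ → ℝ) → ℝ → ℝ≥0∞}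
    (hψ : Measurable (Function.uncurry ψ))
    (hinv : ∀ x s t, ψ (Function.update x j s) t = ψ x t) :
    ∫⁻ x, ψ x (x j) ∂unifSeq = ∫⁻ x, ∫⁻ s, ψ x s ∂unif ∂unifSeq := by
  have hm : Measurable fun x : ℕ → ℝ => ψ x (x j) :=
    hψ.comp (measurable_id.prodMk (measurable_pi_apply j))
  conv_lhs => rw [← map_update_unifSeq j]
  rw [lintegral_map hm (measurable_update_prod j)]
  simp only [hinv, Function.update_self]
  exact lintegral_prod _ hψ.aemeasurable

/-! ### The record times of an i.i.d. uniform sequence -/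

/-- The sequences in `E` for which `j` is the first index after `m` with `x m < x j`. -/
def exceedEvent (E : Set (ℕ → ℝ)) (m j : ℕ) : Set (ℕ → ℝ) :=
  {x | x ∈ E ∧ (∀ i, m < i → i < j → x i ≤ x m) ∧ m < j ∧ x m < x j}

/-- The sequences in `E` for which `x m` is not exceeded at the next `k` indices. -/
def stayEvent (E : Set (ℕ → ℝ)) (m k : ℕ) : Set (ℕ → ℝ) :=
  {x | x ∈ E ∧ ∀ i, m < i → i < m + 1 + k → x i ≤ x m}

/-- The sequences with at least `n + 1` records for which `m` is the index of the `n`-th one, when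
counting from zero. -/
def recordEvent : ℕ → ℕ → Set (ℕ → ℝ)
  | 0, m => {_x | m = 0}
  | n + 1, j => ⋃ m, exceedEvent (recordEvent n m) m j

theorem measurableSet_stayEvent {E : Set (ℕ → ℝ)} (hE : MeasurableSet E) (m k : ℕ) :
    MeasurableSet (stayEvent E m k) := by
  have : stayEvent E m k = E ∩ ⋂ i, ⋂ (_ : m < i), ⋂ (_ : i < m + 1 + k), {x | x i ≤ x m} := by
    ext x
    simp [stayEvent]
  rw [this]
  exact hE.inter (MeasurableSet.iInter fun i => MeasurableSet.iInter fun _ =>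
    MeasurableSet.iInter fun _ => measurableSet_le (measurable_pi_apply i) (measurable_pi_apply m))

theorem exceedEvent_eq (E : Set (ℕ → ℝ)) (m k : ℕ) :
    exceedEvent E m (m + 1 + k) = stayEvent E m k ∩ {x | x m < x (m + 1 + k)} := by
  ext x
  have : m < m + 1 + k := by omega
  simp only [exceedEvent, stayEvent, this, true_and, mem_ofPred_eq, mem_inter_iff, and_assoc]

theorem exceedEvent_of_le (E : Set (ℕ → ℝ)) {m j : ℕ} (h : j ≤ m) : exceedEvent E m j = ∅ := by
  ext x
  simp [exceedEvent, not_lt.2 h]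

theorem measurableSet_exceedEvent {E : Set (ℕ → ℝ)} (hE : MeasurableSet E) (m j : ℕ) :
    MeasurableSet (exceedEvent E m j) := by
  rcases le_or_gt j m with h | h
  · rw [exceedEvent_of_le E h]
    exact MeasurableSet.empty
  · obtain ⟨k, rfl⟩ := Nat.exists_eq_add_of_le (Nat.succ_le_of_lt h)
    exact (exceedEvent_eq E m k) ▸ (measurableSet_stayEvent hE m k).inter
      (measurableSet_lt (measurable_pi_apply m) (measurable_pi_apply _))

theorem measurableSet_recordEvent (n m : ℕ) : MeasurableSet (recordEvent n m) := by
  induction n generalizing m with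
  | zero => exact MeasurableSet.const _
  | succ n ih => exact MeasurableSet.iUnion fun i => measurableSet_exceedEvent (ih i) i m

/-- Membership certifies that each successive record exists, so every `sInf` is attained and the
default `sInf ∅ = 0` never enters. -/
theorem recordTime_eq_of_mem_recordEvent {n m : ℕ} {x : ℕ → ℝ} (hx : x ∈ recordEvent n m) :
    recordTime x n = m := by
  induction n generalizing m with
  | zero => exact (show m = 0 from hx).symm
  | succ n ih =>
    obtain ⟨i, hi, hstay, him, hlt⟩ := mem_iUnion.1 hx
    have hi := ih hi
    rw [recordTime, hi]
    refine IsLeast.csInf_eq ⟨⟨him, hlt⟩, fun j hj => ?_⟩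
    by_contra hjm
    exact absurd (hstay j hj.1 (not_le.1 hjm)) (not_le.2 hj.2)

/-- The event depends only on coordinates up to `m`, which is what allows later coordinates to be
resampled. -/
theorem update_mem_recordEvent_iff {n m j : ℕ} (hj : m < j) (x : ℕ → ℝ) (s : ℝ) :
    Function.update x j s ∈ recordEvent n m ↔ x ∈ recordEvent n m := by
  induction n generalizing m with
  | zero => exact Iff.rfl
  | succ n ih =>
    simp only [recordEvent, mem_iUnion, exceedEvent, mem_ofPred_eq]
    refine exists_congr fun i => ?_
    constructor
    · rintro ⟨h1, h2, h3, h4⟩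
      have hi : i ≠ j := by omega
      rw [Function.update_of_ne hi, Function.update_of_ne hj.ne] at h4
      refine ⟨(ih (by omega)).1 h1, fun l hl hl' => ?_, h3, h4⟩
      simpa [Function.update_of_ne hi, Function.update_of_ne (show l ≠ j by omega)] using h2 l hl hl'
    · rintro ⟨h1, h2, h3, h4⟩
      have hi : i ≠ j := by omega
      rw [Function.update_of_ne hi, Function.update_of_ne hj.ne]
      refine ⟨(ih (by omega)).2 h1, fun l hl hl' => ?_, h3, h4⟩
      simpa [Function.update_of_ne (show l ≠ j by omega)] using h2 l hl hl'

theorem update_mem_stayEvent_iff {E : Set (ℕ → ℝ)} {m : ℕ}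
    (hinv : ∀ j, m < j → ∀ x s, Function.update x j s ∈ E ↔ x ∈ E) (k : ℕ) (x : ℕ → ℝ) (s : ℝ) :
    Function.update x (m + 1 + k) s ∈ stayEvent E m k ↔ x ∈ stayEvent E m k := by
  simp only [stayEvent, mem_ofPred_eq, hinv (m + 1 + k) (by omega)]
  refine and_congr_right fun _ => forall_congr' fun i => forall_congr' fun _ =>
    forall_congr' fun hi => ?_
  rw [Function.update_of_ne hi.ne, Function.update_of_ne (show m ≠ m + 1 + k by omega)]

theorem measurable_unif_Iic : Measurable fun r => unif (Iic r) :=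
  Monotone.measurable fun _ _ h => measure_mono (Iic_subset_Iic.2 h)

theorem measurable_setLIntegral_Ioi_unif (f : ℝ → ℝ≥0∞) :
    Measurable fun r => ∫⁻ s in Ioi r, f s ∂unif :=
  Antitone.measurable fun _ _ h => lintegral_mono_set (Ioi_subset_Ioi h)

theorem setLIntegral_stayEvent_resample {E : Set (ℕ → ℝ)} (hE : MeasurableSet E) {m : ℕ}
    (hinv : ∀ j, m < j → ∀ x s, Function.update x j s ∈ E ↔ x ∈ E) (k : ℕ)
    {ψ : ℝ → ℝ → ℝ≥0∞} (hψ : Measurable (Function.uncurry ψ)) :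
    ∫⁻ x in stayEvent E m k, ψ (x m) (x (m + 1 + k)) ∂unifSeq =
      ∫⁻ x in stayEvent E m k, ∫⁻ s, ψ (x m) s ∂unif ∂unifSeq := by
  classical
  have hS := measurableSet_stayEvent hE m k
  rw [← lintegral_indicator hS, ← lintegral_indicator hS]
  have h := lintegral_unifSeq_resample (m + 1 + k)
    (ψ := fun x s => (stayEvent E m k).indicator (fun x => ψ (x m) s) x) ?_ ?_
  · refine Eq.trans ?_ (h.trans ?_)
    · refine lintegral_congr fun x => ?_
      simp only [indicator_apply]
    · refine lintegral_congr fun x => ?_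
      by_cases hx : x ∈ stayEvent E m k <;> simp [hx]
  · have : (Function.uncurry fun (x : ℕ → ℝ) s =>
        (stayEvent E m k).indicator (fun x => ψ (x m) s) x) =
        (Prod.fst ⁻¹' stayEvent E m k).indicator fun p => Function.uncurry ψ (p.1 m, p.2) := by
      ext ⟨x, s⟩
      simp only [Function.uncurry, indicator_apply, mem_preimage]
    rw [this]
    exact (hψ.comp (((measurable_pi_apply m).comp measurable_fst).prodMk
      measurable_snd)).indicator (measurable_fst hS)
  · intro x s t
    simp only [indicator_apply, update_mem_stayEvent_iff hinv,
      Function.update_of_ne (show m ≠ m + 1 + k by omega)]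

/-- Each extra index without a record is resampled and contributes one factor `unif (Iic (x m))`.
The induction generalises `h` so that it can absorb this factor. -/
theorem setLIntegral_stayEvent {E : Set (ℕ → ℝ)} (hE : MeasurableSet E) {m : ℕ}
    (hinv : ∀ j, m < j → ∀ x s, Function.update x j s ∈ E ↔ x ∈ E) (k : ℕ)
    {h : ℝ → ℝ≥0∞} (hh : Measurable h) :
    ∫⁻ x in stayEvent E m k, h (x m) ∂unifSeq =
      ∫⁻ x in E, unif (Iic (x m)) ^ k * h (x m) ∂unifSeq := by
  induction k generalizing h with
  | zero =>
    have : stayEvent E m 0 = E := by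
      ext x
      simp only [stayEvent, mem_ofPred_eq, and_iff_left_iff_imp]
      intro _ i h1 h2
      omega
    simp [this]
  | succ k ih =>
    have e : stayEvent E m (k + 1) = {x | x (m + 1 + k) ≤ x m} ∩ stayEvent E m k := by
      ext x
      simp only [stayEvent, mem_inter_iff, mem_ofPred_eq]
      constructor
      · rintro ⟨h1, h2⟩
        exact ⟨h2 _ (by omega) (by omega), h1, fun i hi hi' => h2 i hi (by omega)⟩
      · rintro ⟨h0, h1, h2⟩
        refine ⟨h1, fun i hi hi' => ?_⟩
        rcases eq_or_ne i (m + 1 + k) with rfl | hne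
        · exact h0
        · exact h2 i hi (by omega)
    have hle : MeasurableSet {x : ℕ → ℝ | x (m + 1 + k) ≤ x m} :=
      measurableSet_le (measurable_pi_apply _) (measurable_pi_apply _)
    rw [e, ← Measure.restrict_restrict hle, ← lintegral_indicator hle]
    have hψ : Measurable (Function.uncurry fun r s : ℝ => (Iic r).indicator (fun _ => h r) s) := by
      have : (Function.uncurry fun r s : ℝ => (Iic r).indicator (fun _ => h r) s) =
          {p : ℝ × ℝ | p.2 ≤ p.1}.indicator fun p => h p.1 := by
        ext ⟨r, s⟩
        simp [indicator_apply]
      rw [this]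
      exact (hh.comp measurable_fst).indicator (measurableSet_le measurable_snd measurable_fst)
    refine (setLIntegral_stayEvent_resample hE hinv k hψ).trans ?_
    simp only [lintegral_indicator_const measurableSet_Iic]
    refine (ih (hh.mul measurable_unif_Iic)).trans ?_
    refine lintegral_congr fun x => ?_
    rw [Pi.mul_apply, pow_succ]
    ring

theorem setLIntegral_exceedEvent {E : Set (ℕ → ℝ)} (hE : MeasurableSet E) {m : ℕ}
    (hinv : ∀ j, m < j → ∀ x s, Function.update x j s ∈ E ↔ x ∈ E) (k : ℕ)
    {f : ℝ → ℝ≥0∞} (hf : Measurable f) :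
    ∫⁻ x in exceedEvent E m (m + 1 + k), f (x (m + 1 + k)) ∂unifSeq =
      ∫⁻ x in E, unif (Iic (x m)) ^ k * ∫⁻ s in Ioi (x m), f s ∂unif ∂unifSeq := by
  have hlt : MeasurableSet {x : ℕ → ℝ | x m < x (m + 1 + k)} :=
    measurableSet_lt (measurable_pi_apply _) (measurable_pi_apply _)
  rw [exceedEvent_eq, inter_comm, ← Measure.restrict_restrict hlt, ← lintegral_indicator hlt]
  have hψ : Measurable (Function.uncurry fun r s : ℝ => (Ioi r).indicator f s) := by
    have : (Function.uncurry fun r s : ℝ => (Ioi r).indicator f s) =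
        {p : ℝ × ℝ | p.1 < p.2}.indicator fun p => f p.2 := by
      ext ⟨r, s⟩
      simp [indicator_apply]
    rw [this]
    exact (hf.comp measurable_snd).indicator (measurableSet_lt measurable_fst measurable_snd)
  refine (setLIntegral_stayEvent_resample hE hinv k hψ).trans ?_
  simp only [lintegral_indicator measurableSet_Ioi]
  exact setLIntegral_stayEvent hE hinv k (measurable_setLIntegral_Ioi_unif f)

/-- The integral of `f` with respect to the law of the `n`-th record value, counting from zero, on
the event that this record exists. -/
noncomputable def recordLIntegral (n : ℕ) (f : ℝ → ℝ≥0∞) : ℝ≥0∞ :=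
  ∑' m, ∫⁻ x in recordEvent n m, f (x m) ∂unifSeq

theorem recordLIntegral_zero {f : ℝ → ℝ≥0∞} (hf : Measurable f) :
    recordLIntegral 0 f = ∫⁻ s, f s ∂unif := by
  rw [recordLIntegral, tsum_eq_single 0]
  · have : recordEvent 0 0 = univ := by
      ext x
      simp [recordEvent]
    rw [this, Measure.restrict_univ]
    exact (measurePreserving_eval_infinitePi (fun _ : ℕ => unif) 0).lintegral_comp hf
  · intro m hm
    have : recordEvent 0 m = ∅ := by
      ext x
      simp [recordEvent, hm]
    simp [this]

theorem tsum_eq_tsum_nat_add_of_eq_zero {a : ℕ → ℝ≥0∞} (N : ℕ) (h : ∀ j < N, a j = 0) :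
    ∑' j, a j = ∑' k, a (N + k) := by
  rw [← Summable.sum_add_tsum_nat_add' (k := N) (f := a) ENNReal.summable,
    Finset.sum_eq_zero fun j hj => h j (Finset.mem_range.1 hj), zero_add]
  exact tsum_congr fun k => by rw [add_comm]

/-- Split by the index of the current record and by the waiting time `k`; the geometric series over
`k` produces `(1 - unif (Iic r))⁻¹`. In `ℝ≥0∞` the series needs no bound on its ratio. -/
theorem recordLIntegral_succ (n : ℕ) {f : ℝ → ℝ≥0∞} (hf : Measurable f) :
    recordLIntegral (n + 1) f =
      recordLIntegral n fun r => (1 - unif (Iic r))⁻¹ * ∫⁻ s in Ioi r, f s ∂unif := by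
  have h1 : ∀ j, ∫⁻ x in recordEvent (n + 1) j, f (x j) ∂unifSeq =
      ∑' m, ∫⁻ x in exceedEvent (recordEvent n m) m j, f (x j) ∂unifSeq := by
    intro j
    refine lintegral_iUnion (fun m => measurableSet_exceedEvent (measurableSet_recordEvent n m) m j)
      (fun a b hab => Set.disjoint_left.2 fun x hxa hxb => hab ?_) _
    rw [← recordTime_eq_of_mem_recordEvent hxa.1, recordTime_eq_of_mem_recordEvent hxb.1]
  have h2 : ∀ m, ∑' j, ∫⁻ x in exceedEvent (recordEvent n m) m j, f (x j) ∂unifSeq =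
      ∑' k, ∫⁻ x in exceedEvent (recordEvent n m) m (m + 1 + k), f (x (m + 1 + k)) ∂unifSeq := by
    intro m
    refine tsum_eq_tsum_nat_add_of_eq_zero (m + 1) fun j hj => ?_
    rw [exceedEvent_of_le _ (Nat.lt_succ_iff.1 hj), Measure.restrict_empty, lintegral_zero_measure]
  simp only [recordLIntegral, h1]
  rw [ENNReal.tsum_comm]
  refine tsum_congr fun m => ?_
  have hgm : ∀ k, Measurable fun x : ℕ → ℝ =>
      unif (Iic (x m)) ^ k * ∫⁻ s in Ioi (x m), f s ∂unif := fun k =>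
    ((measurable_unif_Iic.comp (measurable_pi_apply m)).pow_const k).mul
      ((measurable_setLIntegral_Ioi_unif f).comp (measurable_pi_apply m))
  rw [h2, tsum_congr fun k => setLIntegral_exceedEvent (measurableSet_recordEvent n m)
    (fun j hj x s => update_mem_recordEvent_iff hj x s) k hf,
    ← lintegral_tsum fun k => (hgm k).aemeasurable]
  refine lintegral_congr fun x => ?_
  rw [ENNReal.tsum_mul_right, ENNReal.tsum_geometric]

/-- The density of the `n`-th record value, counting from zero, of a uniform sequence. -/
noncomputable def recordPdf (n : ℕ) (u : ℝ) : ℝ := recL u ^ n / (n.factorial : ℝ)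

theorem measurable_recordPdf (n : ℕ) : Measurable (recordPdf n) :=
  (measurable_recL.pow_const n).div_const _

theorem recordPdf_nonneg (n : ℕ) {u : ℝ} (hu : u ∈ Ioo (0 : ℝ) 1) : 0 ≤ recordPdf n u :=
  div_nonneg (pow_nonneg (recL_pos hu).le n) (by positivity)

theorem hasDerivAt_recordPdf (n : ℕ) {u : ℝ} (hu : u < 1) :
    HasDerivAt (recordPdf (n + 1)) (recordPdf n u * (1 - u)⁻¹) u := by
  refine (((hasDerivAt_recL hu).pow (n + 1)).div_const ((n + 1).factorial : ℝ)).congr_deriv ?_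
  simp only [recordPdf, Nat.factorial_succ, Nat.cast_mul, Nat.add_sub_cancel]
  have h1 : ((n.factorial : ℕ) : ℝ) ≠ 0 := by positivity
  have h2 : ((n + 1 : ℕ) : ℝ) ≠ 0 := by positivity
  field_simp

theorem setLIntegral_recordPdf (n : ℕ) {s : ℝ} (hs : s ∈ Ioo (0 : ℝ) 1) :
    ∫⁻ r in Ioo 0 s, ENNReal.ofReal (recordPdf n r * (1 - r)⁻¹) =
      ENNReal.ofReal (recordPdf (n + 1) s) := by
  have hc : ContinuousOn (fun r => recordPdf n r * (1 - r)⁻¹) (uIcc 0 s) := by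
    intro r hr
    rw [uIcc_of_le hs.1.le] at hr
    have h1 : r < 1 := hr.2.trans_lt hs.2
    have h2 : 1 - r ≠ 0 := by linarith
    unfold recordPdf
    exact ((((continuousAt_recL h1).pow n).div_const _).mul
      ((continuousAt_const.sub continuousAt_id).inv₀ h2)).continuousWithinAt
  have hi := intervalIntegral.integral_eq_sub_of_hasDerivAt
    (fun r hr => hasDerivAt_recordPdf n (((uIcc_of_le hs.1.le ▸ hr : r ∈ Icc 0 s)).2.trans_lt hs.2))
    hc.intervalIntegrable
  have h0 : recordPdf (n + 1) 0 = 0 := by simp [recordPdf, recL]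
  rw [h0, sub_zero, intervalIntegral.integral_of_le hs.1.le, integral_Ioc_eq_integral_Ioo] at hi
  rw [← hi, ofReal_integral_eq_lintegral_ofReal]
  · exact (hc.intervalIntegrable.1).mono_set Ioo_subset_Ioc_self
  · filter_upwards [ae_restrict_mem measurableSet_Ioo] with r hr
    have h1 : r ∈ Ioo (0 : ℝ) 1 := ⟨hr.1, hr.2.trans hs.2⟩
    exact mul_nonneg (recordPdf_nonneg n h1) (inv_nonneg.2 (by linarith [h1.2]))

theorem ae_unif_mem : ∀ᵐ u ∂unif, u ∈ Ioo (0 : ℝ) 1 := ae_restrict_mem measurableSet_Ioo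

theorem inv_one_sub_unif_Iic {r : ℝ} (hr : r ∈ Ioo (0 : ℝ) 1) :
    (1 - unif (Iic r))⁻¹ = ENNReal.ofReal (1 - r)⁻¹ := by
  have h : Iic r ∩ Ioo 0 1 = Ioc 0 r := by
    ext s
    simp only [mem_inter_iff, mem_Iic, mem_Ioo, mem_Ioc]
    constructor
    · rintro ⟨h1, h2, -⟩
      exact ⟨h2, h1⟩
    · rintro ⟨h1, h2⟩
      exact ⟨h2, h1, h2.trans_lt hr.2⟩
  rw [unif, Measure.restrict_apply' measurableSet_Ioo, h, Real.volume_Ioc, sub_zero,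
    ← ENNReal.ofReal_one, ← ENNReal.ofReal_sub _ hr.1.le,
    ENNReal.ofReal_inv_of_pos (sub_pos.2 hr.2)]

/-- After Tonelli, the inner integral over `r < s` of the old density times `(1 - r)⁻¹` is the new
density, since `L' = (1 - u)⁻¹`. -/
theorem recordLIntegral_eq (n : ℕ) {f : ℝ → ℝ≥0∞} (hf : Measurable f) :
    recordLIntegral n f = ∫⁻ s, ENNReal.ofReal (recordPdf n s) * f s ∂unif := by
  induction n generalizing f with
  | zero => simp [recordLIntegral_zero hf, recordPdf]
  | succ n ih =>
    have hg : Measurable fun r => (1 - unif (Iic r))⁻¹ * ∫⁻ s in Ioi r, f s ∂unif :=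
      (measurable_unif_Iic.const_sub 1).inv.mul (measurable_setLIntegral_Ioi_unif f)
    have hq : Measurable fun r => ENNReal.ofReal (recordPdf n r * (1 - r)⁻¹) :=
      ((measurable_recordPdf n).mul (measurable_id.const_sub 1).inv).ennreal_ofReal
    rw [recordLIntegral_succ n hf, ih hg]
    have h1 : ∫⁻ r, ENNReal.ofReal (recordPdf n r) *
        ((1 - unif (Iic r))⁻¹ * ∫⁻ s in Ioi r, f s ∂unif) ∂unif =
        ∫⁻ r, ∫⁻ s, (Ioi r).indicator
          (fun s => ENNReal.ofReal (recordPdf n r * (1 - r)⁻¹) * f s) s ∂unif ∂unif := by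
      refine lintegral_congr_ae ?_
      filter_upwards [ae_unif_mem] with r hr
      rw [lintegral_indicator measurableSet_Ioi, lintegral_const_mul _ hf,
        inv_one_sub_unif_Iic hr, ENNReal.ofReal_mul (recordPdf_nonneg n hr), mul_assoc]
    rw [h1, lintegral_lintegral_swap]
    · refine lintegral_congr_ae ?_
      filter_upwards [ae_unif_mem] with s hs
      have h2 : ∀ r, (Ioi r).indicator
          (fun s => ENNReal.ofReal (recordPdf n r * (1 - r)⁻¹) * f s) s =
          (Iio s).indicator (fun r => ENNReal.ofReal (recordPdf n r * (1 - r)⁻¹) * f s) r := by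
        intro r
        simp [indicator_apply]
      have h3 : Iio s ∩ Ioo 0 1 = Ioo 0 s := by
        ext r
        simp only [mem_inter_iff, mem_Iio, mem_Ioo]
        constructor
        · rintro ⟨h1, h2, -⟩
          exact ⟨h2, h1⟩
        · rintro ⟨h1, h2⟩
          exact ⟨h2, h1, h2.trans hs.2⟩
      rw [lintegral_congr h2, lintegral_indicator measurableSet_Iio, lintegral_mul_const _ hq,
        unif, Measure.restrict_restrict measurableSet_Iio, h3, setLIntegral_recordPdf n hs]
    · have : (Function.uncurry fun r s : ℝ => (Ioi r).indicator
          (fun s => ENNReal.ofReal (recordPdf n r * (1 - r)⁻¹) * f s) s) =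
          {p : ℝ × ℝ | p.1 < p.2}.indicator
            fun p => ENNReal.ofReal (recordPdf n p.1 * (1 - p.1)⁻¹) * f p.2 := by
        ext ⟨r, s⟩
        simp [indicator_apply]
      rw [this]
      exact (((hq.comp measurable_fst).mul (hf.comp measurable_snd)).indicator
        (measurableSet_lt measurable_fst measurable_snd)).aemeasurable

theorem lintegral_recordPdf (n : ℕ) : ∫⁻ s, ENNReal.ofReal (recordPdf n s) ∂unif = 1 := by
  have e : ∀ y, Real.exp (-y) * (y ^ n / (n.factorial : ℝ)) = gammaWeight n y := fun y =>
    mul_comm _ _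
  have h1 : IntegrableOn (recordPdf n) (Ioo 0 1) :=
    (integrableOn_Ioo_comp_recL fun y => y ^ n / (n.factorial : ℝ)).2 (by
      simpa only [e] using integrableOn_gammaWeight n le_rfl)
  have h2 : ∫ s in Ioo (0 : ℝ) 1, recordPdf n s = 1 := by
    refine (integral_Ioo_comp_recL fun y => y ^ n / (n.factorial : ℝ)).trans ?_
    simp only [e]
    rw [integral_Ioi_gammaWeight n le_rfl, gammaTail_zero_right]
  rw [unif, ← ofReal_integral_eq_lintegral_ofReal h1, h2, ENNReal.ofReal_one]
  filter_upwards [ae_restrict_mem measurableSet_Ioo] with s hs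
  exact recordPdf_nonneg n hs

theorem pairwise_disjoint_recordEvent (n : ℕ) :
    Pairwise (Function.onFun Disjoint (recordEvent n)) :=
  fun a b hab => Set.disjoint_left.2 fun x hxa hxb => hab (by
    rw [← recordTime_eq_of_mem_recordEvent hxa, recordTime_eq_of_mem_recordEvent hxb])

/-- Almost surely there are infinitely many records. -/
theorem restrict_iUnion_recordEvent (n : ℕ) :
    unifSeq.restrict (⋃ m, recordEvent n m) = unifSeq := by
  refine Measure.restrict_eq_self_of_ae_mem ?_
  have h : unifSeq (⋃ m, recordEvent n m) = 1 := by
    rw [measure_iUnion (pairwise_disjoint_recordEvent n) (measurableSet_recordEvent n)]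
    -- With `f = 1` the formula gives the probability that the record exists, which is the total
    -- mass of `recordPdf n`.
    have h1 := recordLIntegral_eq n (f := fun _ => 1) measurable_const
    simpa [recordLIntegral, lintegral_recordPdf] using h1
  rw [ae_iff]
  exact (prob_compl_eq_zero_iff (MeasurableSet.iUnion (measurableSet_recordEvent n))).2 h

theorem recordValue_succ_of_mem {n m : ℕ} {x : ℕ → ℝ} (hx : x ∈ recordEvent n m) :
    recordValue x (n + 1) = x m := by
  rw [recordValue, Nat.add_sub_cancel, recordTime_eq_of_mem_recordEvent hx]

theorem aemeasurable_recordValue_succ (n : ℕ) :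
    AEMeasurable (fun x => recordValue x (n + 1)) unifSeq := by
  rw [← restrict_iUnion_recordEvent n, aemeasurable_iUnion_iff]
  intro m
  refine (measurable_pi_apply m).aemeasurable.congr ?_
  filter_upwards [ae_restrict_mem (measurableSet_recordEvent n m)] with x hx
  exact (recordValue_succ_of_mem hx).symm

theorem map_recordValue_succ (n : ℕ) :
    unifSeq.map (fun x => recordValue x (n + 1)) =
      unif.withDensity fun u => ENNReal.ofReal (recordPdf n u) := by
  refine Measure.ext_of_lintegral _ fun f hf => ?_
  rw [lintegral_map' hf.aemeasurable (aemeasurable_recordValue_succ n),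
    lintegral_withDensity_eq_lintegral_mul _ (measurable_recordPdf n).ennreal_ofReal hf]
  refine Eq.trans ?_ (recordLIntegral_eq n hf)
  conv_lhs => rw [← restrict_iUnion_recordEvent n]
  rw [lintegral_iUnion (measurableSet_recordEvent n) (pairwise_disjoint_recordEvent n)]
  exact tsum_congr fun m => setLIntegral_congr_fun (measurableSet_recordEvent n m) fun x hx => by
    simp only [recordValue_succ_of_mem hx]

/-! ### Expected records of `X_λ` -/

theorem isExpectedRecordSeq_stieltjesX {lam : ℝ} (hlam : lam ∈ Icc (-1 : ℝ) 1) :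
    IsExpectedRecordSeq (stieltjesX lam) (fun n =>
      ∑ k ∈ Finset.range (n - 1), Real.exp ((k : ℝ) ^ 2 / 2) / ((k + 1).factorial : ℝ)) := by
  intro n hn
  obtain ⟨n, rfl⟩ := Nat.exists_eq_add_of_le' hn
  have hac : unif.withDensity (fun u => ENNReal.ofReal (recordPdf n u)) ≪ unif :=
    withDensity_absolutelyContinuous _ _
  -- The two functions are only known to agree on `(0,1)`, which carries the law of the record.
  have hae : stieltjesG lam =ᵐ[unifSeq.map fun x => recordValue x (n + 1)]
      invCdf (stieltjesX lam) := by
    rw [map_recordValue_succ]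
    refine hac.ae_le ?_
    filter_upwards [ae_unif_mem] with u hu
    exact (invCdf_stieltjesX hlam hu).symm
  have hsm : AEStronglyMeasurable (invCdf (stieltjesX lam))
      (unifSeq.map fun x => recordValue x (n + 1)) := by
    refine AEStronglyMeasurable.congr ?_ hae
    rw [map_recordValue_succ]
    exact (aemeasurable_stieltjesG lam).aestronglyMeasurable.mono_ac hac
  have hp : ∀ᵐ u ∂unif, (ENNReal.ofReal (recordPdf n u)).toReal = recordPdf n u := by
    filter_upwards [ae_unif_mem] with u hu
    exact ENNReal.toReal_ofReal (recordPdf_nonneg n hu)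
  have hV := aemeasurable_recordValue_succ n
  have hpm := (measurable_recordPdf n).ennreal_ofReal
  constructor
  · refine (integrable_map_measure hsm hV).1 ((integrable_congr hae).1 ?_)
    rw [map_recordValue_succ, integrable_withDensity_iff hpm
      (ae_of_all _ fun _ => ENNReal.ofReal_lt_top)]
    refine Integrable.congr (integrableOn_recL_pow_mul_stieltjesG lam n) ?_
    filter_upwards [hp] with u hu
    rw [hu, recordPdf, mul_comm]
  · refine (integral_map hV hsm).symm.trans ((integral_congr_ae hae).symm.trans ?_)
    rw [map_recordValue_succ, integral_withDensity_eq_integral_toReal_smul hpm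
      (ae_of_all _ fun _ => ENNReal.ofReal_lt_top)]
    refine Eq.trans ?_ (integral_recL_pow_mul_stieltjesG lam n)
    refine integral_congr_ae ?_
    filter_upwards [hp] with u hu
    rw [hu, recordPdf, smul_eq_mul]

/-! ### Differences of the functions `stieltjesG lam` -/

/-- At `t = e^(1/2)` the sine is `sin(π/2) = 1`, so the slope is a nonzero constant times `1 + λ`.
-/
theorem stieltjesSlope_injective_at_exp_half {lam₁ lam₂ : ℝ}
    (h : stieltjesSlope lam₁ (Real.exp (1 / 2)) = stieltjesSlope lam₂ (Real.exp (1 / 2))) :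
    lam₁ = lam₂ := by
  have hpos := Real.exp_pos (1 / 2)
  have hf := (lognormalPdf_pos hpos).ne'
  have h1 : Real.exp (Real.exp (1 / 2)) / Real.exp (1 / 2) ≠ 0 := by positivity
  have h2 := mul_right_cancel₀ hf (mul_left_cancel₀ h1 h)
  rw [Real.log_exp, show Real.pi * (1 / 2) = Real.pi / 2 by ring, Real.sin_pi_div_two] at h2
  linarith

theorem exists_stieltjesG_ne {lam₁ lam₂ : ℝ} (h : lam₁ ≠ lam₂) :
    ∃ u ∈ Ioo (0 : ℝ) 1, stieltjesG lam₁ u ≠ stieltjesG lam₂ u := by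
  by_contra! hall
  refine h (stieltjesSlope_injective_at_exp_half ?_)
  have hpos := Real.exp_pos (1 / 2)
  refine (hasDerivAt_stieltjesH lam₁ hpos).unique
    ((hasDerivAt_stieltjesH lam₂ hpos).congr_of_eventuallyEq ?_)
  filter_upwards [lt_mem_nhds hpos] with y hy
  simpa [stieltjesG_eq, recL_one_sub_exp_neg] using hall _ (one_sub_exp_neg_mem_Ioo hy)

/-- By continuity the set is open, and a nonempty open set has positive measure. -/
theorem volume_stieltjesG_sub_ne_zero_pos {lam₁ lam₂ : ℝ} (h : lam₁ ≠ lam₂) :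
    0 < volume {u ∈ Ioo (0 : ℝ) 1 | stieltjesG lam₁ u - stieltjesG lam₂ u ≠ 0} := by
  obtain ⟨u, hu, hne⟩ := exists_stieltjesG_ne h
  have hopen : IsOpen (Ioo (0 : ℝ) 1 ∩
      (fun u => stieltjesG lam₁ u - stieltjesG lam₂ u) ⁻¹' {0}ᶜ) :=
    ((continuousOn_stieltjesG lam₁).sub (continuousOn_stieltjesG lam₂)).isOpen_inter_preimage
      isOpen_Ioo isOpen_compl_singleton
  exact hopen.measure_pos volume ⟨u, hu, sub_ne_zero.2 hne⟩

theorem integrableOn_stieltjesG_mul_recL_pow (lam : ℝ) (k : ℕ) :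
    IntegrableOn (fun u => stieltjesG lam u * recL u ^ k) (Ioo 0 1) := by
  have hk : (k.factorial : ℝ) ≠ 0 := by positivity
  refine IntegrableOn.congr_fun
    ((integrableOn_recL_pow_mul_stieltjesG lam k).const_mul (k.factorial : ℝ))
    (fun u _ => ?_) measurableSet_Ioo
  field_simp

theorem integral_stieltjesG_mul_recL_pow (lam : ℝ) (k : ℕ) :
    ∫ u in Ioo (0 : ℝ) 1, stieltjesG lam u * recL u ^ k = (k.factorial : ℝ) *
      ∑ j ∈ Finset.range k, Real.exp ((j : ℝ) ^ 2 / 2) / ((j + 1).factorial : ℝ) := by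
  have hk : (k.factorial : ℝ) ≠ 0 := by positivity
  rw [← integral_recL_pow_mul_stieltjesG lam, ← integral_const_mul]
  refine setIntegral_congr_fun measurableSet_Ioo fun u _ => ?_
  field_simp

theorem stieltjesG_sub_mem_HUnit (lam₁ lam₂ : ℝ) :
    (fun u => stieltjesG lam₁ u - stieltjesG lam₂ u) ∈ HUnit := fun k => by
  simp only [sub_mul]
  exact (integrableOn_stieltjesG_mul_recL_pow lam₁ k).sub
    (integrableOn_stieltjesG_mul_recL_pow lam₂ k)

theorem integral_stieltjesG_sub_mul_recL_pow (lam₁ lam₂ : ℝ) (k : ℕ) :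
    ∫ u in Ioo (0 : ℝ) 1, (stieltjesG lam₁ u - stieltjesG lam₂ u) * recL u ^ k = 0 := by
  simp only [sub_mul]
  rw [integral_sub (integrableOn_stieltjesG_mul_recL_pow lam₁ k)
    (integrableOn_stieltjesG_mul_recL_pow lam₂ k), integral_stieltjesG_mul_recL_pow,
    integral_stieltjesG_mul_recL_pow, sub_self]

theorem stieltjesX_ne {lam₁ lam₂ : ℝ} (h₁ : lam₁ ∈ Icc (-1 : ℝ) 1) (h₂ : lam₂ ∈ Icc (-1 : ℝ) 1)
    (h : lam₁ ≠ lam₂) : stieltjesX lam₁ ≠ stieltjesX lam₂ := by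
  obtain ⟨u, hu, hne⟩ := exists_stieltjesG_ne h
  exact fun hX => hne (by rw [← invCdf_stieltjesX h₁ hu, ← invCdf_stieltjesX h₂ hu, hX])

theorem not_isCompleteIn_recL_pow : ¬ IsCompleteIn (fun k u => recL u ^ k) HUnit := by
  intro hc
  -- Any two distinct parameters in `[-1, 1]` would serve; here `0` is the lognormal law itself.
  have h := hc _ (stieltjesG_sub_mem_HUnit 0 1) (integral_stieltjesG_sub_mul_recL_pow 0 1)
  refine (volume_stieltjesG_sub_ne_zero_pos (zero_ne_one' ℝ)).ne' ?_
  rw [measure_eq_zero_iff_ae_notMem]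
  filter_upwards [(ae_restrict_iff' measurableSet_Ioo).1 h] with u hu hu'
  exact hu'.2 (hu hu'.1)

theorem mainTheorem9 :
    (∃ X : ℝ → Measure ℝ,
      (∀ lam ∈ Icc (-1 : ℝ) 1,
        -- `T_λ` belongs to the space `T` and has the moments of the lognormal law
        stieltjesLaw lam ∈ TSpace ∧
        (∀ n : ℕ, ∫ t, t ^ n ∂(stieltjesLaw lam) = Real.exp ((n : ℝ) ^ 2 / 2)) ∧
        -- `X_λ` is the unique element of `H_0` that `φ` maps to `T_λ`
        X lam ∈ HZero ∧
        phi (X lam) = stieltjesLaw lam ∧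
        (∀ μ ∈ HZero, phi μ = stieltjesLaw lam → μ = X lam) ∧
        -- its inverse distribution function is `G_λ`, and it is absolutely continuous
        (∀ u ∈ Ioo (0 : ℝ) 1, invCdf (X lam) u = stieltjesG lam u) ∧
        X lam ≪ volume ∧
        -- its expected record sequence does not depend on `λ`
        IsExpectedRecordSeq (X lam) (fun n =>
          ∑ k ∈ Finset.range (n - 1), Real.exp ((k : ℝ) ^ 2 / 2) / ((k + 1).factorial : ℝ)) ∧
        (∀ n : ℕ, 1 ≤ n →
          IntegrableOn
            (fun u => recL u ^ (n - 1) / ((n - 1).factorial : ℝ) * stieltjesG lam u) (Ioo 0 1) ∧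
          ∫ u in Ioo (0 : ℝ) 1,
              recL u ^ (n - 1) / ((n - 1).factorial : ℝ) * stieltjesG lam u =
            ∑ k ∈ Finset.range (n - 1),
              Real.exp ((k : ℝ) ^ 2 / 2) / ((k + 1).factorial : ℝ))) ∧
      -- the `X_λ` are distinct, and so are their inverse distribution functions
      (∀ lam₁ ∈ Icc (-1 : ℝ) 1, ∀ lam₂ ∈ Icc (-1 : ℝ) 1, lam₁ ≠ lam₂ →
        X lam₁ ≠ X lam₂ ∧
        (fun u => stieltjesG lam₁ u - stieltjesG lam₂ u) ∈ HUnit ∧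
        0 < volume {u ∈ Ioo (0 : ℝ) 1 | stieltjesG lam₁ u - stieltjesG lam₂ u ≠ 0} ∧
        (∀ k : ℕ,
          ∫ u in Ioo (0 : ℝ) 1, (stieltjesG lam₁ u - stieltjesG lam₂ u) * recL u ^ k = 0))) ∧
    -- the system `L^k` is not complete in `H(0,1)`
    ¬ IsCompleteIn (fun k u => recL u ^ k) HUnit := by
  refine ⟨⟨stieltjesX, fun lam hlam => ⟨stieltjesLaw_mem_TSpace hlam,
    integral_pow_stieltjesLaw hlam, stieltjesX_mem_HZero hlam, phi_stieltjesX hlam,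
    fun μ hμ h => eq_stieltjesX_of_phi_eq hlam hμ h, fun u hu => invCdf_stieltjesX hlam hu,
    stieltjesX_absolutelyContinuous hlam, isExpectedRecordSeq_stieltjesX hlam,
    fun n _ => ⟨integrableOn_recL_pow_mul_stieltjesG lam (n - 1),
      integral_recL_pow_mul_stieltjesG lam (n - 1)⟩⟩,
    fun lam₁ h₁ lam₂ h₂ h => ⟨stieltjesX_ne h₁ h₂ h, stieltjesG_sub_mem_HUnit lam₁ lam₂,
      volume_stieltjesG_sub_ne_zero_pos h, integral_stieltjesG_sub_mul_recL_pow lam₁ lam₂⟩⟩,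
    not_isCompleteIn_recL_pow⟩
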